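/- Let $0<y<1$ and let $k\in\mathbb C$ with $\operatorname{Re}k>-1$ and $k\notin\{1,3,5,\dots\}$. Let ${}_2F_1$ and ${}_3F_2$ denote the analytic continuations to $\mathbb C\setminus[1,\infty)$ of the corresponding hypergeometric series on the unit disc, and let their values at real $x>1$ be the limits from the lower half-plane, i.e. the values at $x-i0$. Put $$A(k,y)=\frac{2}{(k+1)(y-y^{-1})^2}\;{}_3F_2\Big(\tfrac12,1,1;\tfrac{1-k}{2},\tfrac{3+k}{2};-\tfrac{4}{(y-y^{-1})^2}\Big),$$ $$B(k,y)=\frac{y}{y^2-y^{-2}}\Big\{\frac1k\big[{}_2F_1(1,k;k+1;y)-{}_2F_1(1,k;k+1;-y)\big]-\frac1{k+2}\big[{}_2F_1(1,k+2;k+3;y)-{}_2F_1(1,k+2;k+3;-y)\big]\Big\}.$$ Then $$A(k,y)+A(-k,y)=\frac{\pi y^{k}}{y+y^{-1}}\Big(i+\tan\frac{\pi k}{2}\Big)+B(k,y)+B(k,y^{-1}),$$ where for $k=0$ the right-hand side (which has a removable singularity there) is understood as its limit as $k\to0$, $k\neq0$. -/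

import Mathlib

open Complex Filter Topology

noncomputable section

namespace Hypergeom

/-- The complex plane cut along the real half-line `[1, ∞)`. -/
def cutPlane : Set ℂ := {z | 1 - z ∈ slitPlane}

/-- `f` is an analytic continuation to `ℂ \ [1, ∞)` of the function `g`, given on the open
unit disc. -/
def IsContinuation (g f : ℂ → ℂ) : Prop :=
  AnalyticOnNhd ℂ f cutPlane ∧ Set.EqOn f g (Metric.ball 0 1)

/-- The continuation to the cut plane is unique. -/
theorem IsContinuation.eqOn {g f₁ f₂ : ℂ → ℂ} (h₁ : IsContinuation g f₁)
    (h₂ : IsContinuation g f₂) : Set.EqOn f₁ f₂ cutPlane := by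
  have hstar : StarConvex ℝ (0 : ℂ) cutPlane := by
    intro z hz a b ha hb hab
    have h := starConvex_one_slitPlane hz ha hb hab
    have e : 1 - (a • (0 : ℂ) + b • z) = a • (1 : ℂ) + b • (1 - z) := by
      have : (a : ℂ) + b = 1 := by exact_mod_cast hab
      simp only [real_smul]
      linear_combination -this
    change 1 - (a • (0 : ℂ) + b • z) ∈ slitPlane
    rw [e]
    exact h
  have h0 : (0 : ℂ) ∈ cutPlane := by simp [cutPlane]
  refine h₁.1.eqOn_of_preconnected_of_eventuallyEq h₂.1
    (hstar.isPathConnected h0).isConnected.isPreconnected h0 ?_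
  filter_upwards [Metric.ball_mem_nhds (0 : ℂ) one_pos] with z hz
  exact (h₁.2 hz).trans (h₂.2 hz).symm

open Classical in
/-- The analytic continuation of `g` from the unit disc to `ℂ \ [1, ∞)` (the zero function if
there is none). -/
def continuation (g : ℂ → ℂ) : ℂ → ℂ :=
  if h : ∃ f, IsContinuation g f then h.choose else 0

open Classical in
/-- The principal value of the continuation of `g`: on the cut plane it is the analytic
continuation, and at a point of the cut `[1, ∞)` it is the limit from the lower half-plane. -/
def principalValue (g : ℂ → ℂ) (z : ℂ) : ℂ :=
  if z ∈ cutPlane then continuation g z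
  else limUnder (𝓝[{w : ℂ | w.im < 0}] z) (continuation g)

/-- The principal branch of `₂F₁(a, b; c; z)`. -/
def F21 (a b c z : ℂ) : ℂ :=
  principalValue (fun w => ordinaryHypergeometric a b c w) z

/-- The coefficients `(a₁)ₙ (a₂)ₙ (a₃)ₙ / ((b₁)ₙ (b₂)ₙ n!)` of the series of `₃F₂`. -/
def coeff32 (a₁ a₂ a₃ b₁ b₂ : ℂ) (n : ℕ) : ℂ :=
  (ascPochhammer ℂ n).eval a₁ * (ascPochhammer ℂ n).eval a₂ * (ascPochhammer ℂ n).eval a₃ /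
    ((ascPochhammer ℂ n).eval b₁ * (ascPochhammer ℂ n).eval b₂ * (n.factorial : ℂ))

/-- The principal branch of `₃F₂(a₁, a₂, a₃; b₁, b₂; z)`. -/
def F32 (a₁ a₂ a₃ b₁ b₂ z : ℂ) : ℂ :=
  principalValue (fun w => ∑' n : ℕ, coeff32 a₁ a₂ a₃ b₁ b₂ n * w ^ n) z

/-- `2 / ((k+1)(y-y⁻¹)²) · ₃F₂(1/2, 1, 1; (1-k)/2, (3+k)/2; -4/(y-y⁻¹)²)`. -/
def termA (k y : ℂ) : ℂ :=
  2 / ((k + 1) * (y - y⁻¹) ^ 2) *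
    F32 (1 / 2) 1 1 ((1 - k) / 2) ((3 + k) / 2) (-4 / (y - y⁻¹) ^ 2)

/-- `y/(y²-y⁻²) · { (1/k) [₂F₁(1,k;k+1;y) - ₂F₁(1,k;k+1;-y)]
  - (1/(k+2)) [₂F₁(1,k+2;k+3;y) - ₂F₁(1,k+2;k+3;-y)] }`. -/
def termB (k y : ℂ) : ℂ :=
  y / (y ^ 2 - (y⁻¹) ^ 2) *
    (1 / k * (F21 1 k (k + 1) y - F21 1 k (k + 1) (-y))
      - 1 / (k + 2) * (F21 1 (k + 2) (k + 3) y - F21 1 (k + 2) (k + 3) (-y)))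

/-- The left-hand side: `termA` plus the same with `k → -k`. -/
def lhs (k y : ℂ) : ℂ := termA k y + termA (-k) y

/-- The right-hand side: only `termB` is symmetrized under `y → y⁻¹`. -/
def rhs (k y : ℂ) : ℂ :=
  Real.pi * y ^ k / (y + y⁻¹) * (I + Complex.tan (Real.pi * k / 2)) + (termB k y + termB k y⁻¹)

end Hypergeom

end

noncomputable section

namespace Hypergeom

/-! Both sides equal `y²/(1+y²) · (L((1+k)/2, y²) + L((1-k)/2, y²))`, where `L(b, z) = ∑ zⁿ/(n+b)`
is `lerch`.

Left side. With `c = (1+k)/2`, `r = √(1-z)` and `w = (r-1)/(r+1)`, the continued `₃F₂` is `c (L(c,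
w) - w L(1-c, w)) / r`. This function and a companion satisfy a first-order system, which forces the
hypergeometric recursion on Taylor coefficients (`cont32_system`, `isContinuation_cont32`). At the
given argument `w = y²`, and adding the `-k` term cancels a factor `1 - y²`.

Right side. Let `Λ(b, z)` be Euler's integral, which continues `L`. Then `₂F₁(1, k; k+1; z) = 1 + k
z Λ(k+1, z)`, and `termB k x` becomes `x²/(x²+1) · (Λ(k+1, x) + Λ(k+1, -x))` plus a rational term
that is odd under `x → x⁻¹`. At `x = y` the even part of the series gives `L((1+k)/2, y²)`. At `x =
y⁻¹` a connection formula is needed (`exists_tendsto_lerchCont_inv`): `u⁻¹ (Λ(k+1, u⁻¹) + Λ(k+1,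
-u⁻¹))` and `u L((1-k)/2, u²)` solve the same first-order equation on the upper half-disc, hence
differ by `C uᵏ`. Comparing boundary values at `y` and `-y`, with the logarithmic jump of `Λ` across
the cut, gives `C (1 + e^{iπk}) = -2πi`, so `C = -π (i + tan(πk/2))`; this cancels the explicit
term.

At `k = 0` the closed form is continuous, which gives the limit. -/

/-! ### Power series on the unit disc -/

theorem exists_norm_lt_one_between {z : ℂ} (hz : z ∈ Metric.ball (0 : ℂ) 1) :
    ∃ ρ : ℝ, ‖z‖ < ρ ∧ 0 ≤ ρ ∧ ρ < 1 := by
  obtain ⟨ρ, h1, h2⟩ := exists_between (mem_ball_zero_iff.1 hz)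
  exact ⟨ρ, h1, (norm_nonneg z).trans h1.le, h2⟩

/-- The Euler operator acts diagonally on the coefficients of a power series. -/
theorem hasSum_mul_deriv {a : ℕ → ℂ} {f : ℂ → ℂ}
    (h : ∀ z ∈ Metric.ball (0 : ℂ) 1, HasSum (fun n => a n * z ^ n) (f z)) {z : ℂ}
    (hz : z ∈ Metric.ball (0 : ℂ) 1) :
    HasSum (fun n : ℕ => (n : ℂ) * a n * z ^ n) (z * deriv f z) ∧ DifferentiableAt ℂ f z := by
  obtain ⟨ρ, h1, h0, h2⟩ := exists_norm_lt_one_between hz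
  have hρ : (ρ : ℂ) ∈ Metric.ball (0 : ℂ) 1 := by simpa [abs_of_nonneg h0] using h2
  have hu : Summable fun n => ‖a n‖ * ρ ^ n := by
    simpa [abs_of_nonneg h0] using (h _ hρ).summable.norm
  have hU : IsOpen (Metric.ball (0 : ℂ) ρ) := Metric.isOpen_ball
  have hzU : z ∈ Metric.ball (0 : ℂ) ρ := mem_ball_zero_iff.2 h1
  have hd : ∀ n : ℕ, DifferentiableOn ℂ (fun w : ℂ => a n * w ^ n) (Metric.ball 0 ρ) :=
    fun n => by fun_prop
  have hle : ∀ (n : ℕ) (w : ℂ), w ∈ Metric.ball (0 : ℂ) ρ → ‖a n * w ^ n‖ ≤ ‖a n‖ * ρ ^ n := by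
    intro n w hw
    rw [norm_mul, norm_pow]
    have := (mem_ball_zero_iff.1 hw).le
    gcongr
  have hfe : f =ᶠ[𝓝 z] fun w => ∑' n, a n * w ^ n := by
    filter_upwards [hU.mem_nhds hzU] with w hw
    exact ((h w (Metric.ball_subset_ball h2.le hw)).tsum_eq).symm
  refine ⟨?_, ((Complex.differentiableOn_tsum_of_summable_norm hu hd hU hle).differentiableAt
    (hU.mem_nhds hzU)).congr_of_eventuallyEq hfe⟩
  have := (Complex.hasSum_deriv_of_summable_norm hu hd hU hle hzU).mul_left z
  rw [← hfe.deriv_eq] at this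
  refine this.congr_fun ?_
  intro n
  rcases n with _ | n
  · simp
  · simp only [deriv_const_mul_field', deriv_pow_field, Nat.add_sub_cancel]
    ring

/-- The coefficients of a power series are determined by its sum. -/
theorem coeff_eq_of_hasSum {a b : ℕ → ℂ} {f : ℂ → ℂ}
    (ha : ∀ z ∈ Metric.ball (0 : ℂ) 1, HasSum (fun n => a n * z ^ n) (f z))
    (hb : ∀ z ∈ Metric.ball (0 : ℂ) 1, HasSum (fun n => b n * z ^ n) (f z)) : a = b := by
  have key : ∀ c : ℕ → ℂ, (∀ z ∈ Metric.ball (0 : ℂ) 1, HasSum (fun n => c n * z ^ n) (f z)) →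
      HasFPowerSeriesAt f (FormalMultilinearSeries.ofScalars ℂ c) 0 := by
    intro c hc
    rw [hasFPowerSeriesAt_iff]
    filter_upwards [Metric.ball_mem_nhds (0 : ℂ) one_pos] with z hz
    simpa [FormalMultilinearSeries.coeff_ofScalars, mul_comm] using hc z hz
  have := (key a ha).eq_formalMultilinearSeries (key b hb)
  funext n
  have h2 := congrArg (fun p => FormalMultilinearSeries.coeff p n) this
  simpa [FormalMultilinearSeries.coeff_ofScalars] using h2

/-! ### The Lerch-type series -/

/-- The Lerch-type series `∑ zⁿ / (n + b)`. -/
def lerch (b z : ℂ) : ℂ := ∑' n : ℕ, ((n : ℂ) + b)⁻¹ * z ^ n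

/-- The sequence tends to zero. No condition on `b` is needed, since a vanishing `n + b` contributes
`0⁻¹ = 0`. -/
theorem exists_norm_natCast_add_inv_le (b : ℂ) : ∃ M : ℝ, ∀ n : ℕ, ‖((n : ℂ) + b)⁻¹‖ ≤ M := by
  have h : Tendsto (fun n : ℕ => ((n : ℂ) + b)⁻¹) atTop (𝓝 0) := by
    apply tendsto_inv₀_cobounded.comp
    exact (tendsto_add_const_cobounded b).comp tendsto_natCast_atTop_cobounded
  obtain ⟨M, hM⟩ := (Metric.isBounded_range_of_tendsto _ h).exists_norm_le
  exact ⟨M, fun n => hM _ ⟨n, rfl⟩⟩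

theorem hasSum_lerch (b : ℂ) {z : ℂ} (hz : z ∈ Metric.ball (0 : ℂ) 1) :
    HasSum (fun n : ℕ => ((n : ℂ) + b)⁻¹ * z ^ n) (lerch b z) := by
  obtain ⟨M, hM⟩ := exists_norm_natCast_add_inv_le b
  refine Summable.hasSum (Summable.of_norm_bounded
    ((summable_geometric_of_lt_one (norm_nonneg z) (mem_ball_zero_iff.1 hz)).mul_left M) ?_)
  intro n
  rw [norm_mul, norm_pow]
  gcongr
  exact hM n

theorem differentiableOn_lerch (b : ℂ) : DifferentiableOn ℂ (lerch b) (Metric.ball 0 1) :=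
  fun _ hz => (hasSum_mul_deriv (fun _ => hasSum_lerch b) hz).2.differentiableWithinAt

/-- The first-order differential equation of the Lerch-type series. -/
theorem mul_deriv_lerch {b : ℂ} (hb : ∀ n : ℕ, (n : ℂ) + b ≠ 0) {z : ℂ}
    (hz : z ∈ Metric.ball (0 : ℂ) 1) :
    z * deriv (lerch b) z = (1 - z)⁻¹ - b * lerch b z := by
  have h1 := (hasSum_mul_deriv (fun _ => hasSum_lerch b) hz).1.add ((hasSum_lerch b hz).mul_left b)
  have h2 := hasSum_geometric_of_norm_lt_one (mem_ball_zero_iff.1 hz)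
  rw [eq_sub_iff_add_eq]
  refine h1.unique (h2.congr_fun fun n => ?_)
  have := hb n
  field_simp

/-- Odd terms cancel, and the doubled even terms are `2/(2n+b) = 1/(n+b/2)`. -/
theorem lerch_add_lerch_neg (b : ℂ) {z : ℂ} (hz : z ∈ Metric.ball (0 : ℂ) 1) :
    lerch b z + lerch b (-z) = lerch (b / 2) (z ^ 2) := by
  have hz' : -z ∈ Metric.ball (0 : ℂ) 1 := by simpa using hz
  have hz2 : z ^ 2 ∈ Metric.ball (0 : ℂ) 1 := by
    have := mem_ball_zero_iff.1 hz
    rw [mem_ball_zero_iff, norm_pow]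
    exact pow_lt_one₀ (norm_nonneg z) this two_ne_zero
  refine ((hasSum_lerch b hz).add (hasSum_lerch b hz')).unique ?_
  have h1 := hasSum_lerch (b / 2) hz2
  rw [← add_zero (lerch (b / 2) (z ^ 2))]
  refine HasSum.even_add_odd (h1.congr_fun fun n => ?_) (hasSum_zero.congr_fun fun n => ?_)
  · rw [Even.neg_pow (even_two_mul n), pow_mul, ← two_mul, ← mul_assoc]
    congr 1
    push_cast
    rw [show (n : ℂ) + b / 2 = (2 * n + b) / 2 by ring, inv_div, div_eq_mul_inv]
  · rw [Odd.neg_pow ⟨n, rfl⟩]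
    ring

/-- Needed for the limit `k → 0`, where both parameters `(1±k)/2` tend to `1/2`. For `Re b > 1/4`
every coefficient is bounded by 4, so dominated convergence applies. -/
theorem continuousAt_lerch_half {w : ℂ} (hw : w ∈ Metric.ball (0 : ℂ) 1) :
    ContinuousAt (fun b => lerch b w) (1 / 2) := by
  refine tendsto_tsum_of_dominated_convergence (bound := fun n => 4 * ‖w‖ ^ n)
    ((summable_geometric_of_lt_one (norm_nonneg w) (mem_ball_zero_iff.1 hw)).mul_left 4) ?_ ?_
  · intro n
    refine Tendsto.mul_const _ (Tendsto.inv₀ (tendsto_const_nhds.add tendsto_id) ?_)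
    intro h
    have := congrArg Complex.re h
    norm_num at this
    linarith [n.cast_nonneg (α := ℝ)]
  · filter_upwards [(isOpen_lt continuous_const Complex.continuous_re).mem_nhds
      (show (1 / 4 : ℝ) < (1 / 2 : ℂ).re by norm_num)] with b hb n
    rw [norm_mul, norm_pow, norm_inv]
    gcongr
    rw [inv_le_comm₀ _ (by norm_num)]
    · refine le_trans ?_ (Complex.re_le_norm _)
      have : (1 / 4 : ℝ) < b.re := hb
      simp only [add_re, natCast_re]
      linarith [n.cast_nonneg (α := ℝ)]
    · refine lt_of_lt_of_le ?_ (Complex.re_le_norm _)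
      have : (1 / 4 : ℝ) < b.re := hb
      simp only [add_re, natCast_re]
      linarith [n.cast_nonneg (α := ℝ)]

/-! ### Continuation to the cut plane -/

theorem isOpen_cutPlane : IsOpen cutPlane :=
  isOpen_slitPlane.preimage (continuous_const.sub continuous_id)

theorem ball_subset_cutPlane : Metric.ball (0 : ℂ) 1 ⊆ cutPlane := by
  intro z hz
  refine Or.inl ?_
  have := (Complex.re_le_norm z).trans_lt (mem_ball_zero_iff.1 hz)
  simpa using this

theorem IsContinuation.continuation_eqOn {g f : ℂ → ℂ} (h : IsContinuation g f) :
    Set.EqOn (continuation g) f cutPlane := by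
  have hex : ∃ f, IsContinuation g f := ⟨f, h⟩
  rw [continuation, dif_pos hex]
  exact hex.choose_spec.eqOn h

theorem IsContinuation.principalValue_eq {g f : ℂ → ℂ} (h : IsContinuation g f) {z : ℂ}
    (hz : z ∈ cutPlane) : principalValue g z = f z := by
  rw [principalValue, if_pos hz, h.continuation_eqOn hz]

/-- Analytic functions on the cut plane that agree on the unit disc are equal. -/
theorem eqOn_cutPlane_of_eqOn_ball {f g : ℂ → ℂ} (hf : DifferentiableOn ℂ f cutPlane)
    (hg : DifferentiableOn ℂ g cutPlane) (h : Set.EqOn f g (Metric.ball 0 1)) :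
    Set.EqOn f g cutPlane :=
  IsContinuation.eqOn (g := g) ⟨hf.analyticOnNhd isOpen_cutPlane, h⟩
    ⟨hg.analyticOnNhd isOpen_cutPlane, Set.eqOn_refl _ _⟩

/-! ### The Koebe change of variable -/

/-- The principal square root of `1 - z`. -/
def sqrtOneSub (z : ℂ) : ℂ := (1 - z) ^ (2⁻¹ : ℂ)

/-- The inverse of `w ↦ -4w / (1 - w)²`, which maps the cut plane to the unit disc. -/
def koebeInv (z : ℂ) : ℂ := (sqrtOneSub z - 1) / (sqrtOneSub z + 1)

theorem sqrtOneSub_sq (z : ℂ) : sqrtOneSub z ^ 2 = 1 - z := by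
  have := Complex.cpow_nat_inv_pow (1 - z) two_ne_zero
  exact_mod_cast this

theorem sqrtOneSub_re_pos {z : ℂ} (hz : z ∈ cutPlane) : 0 < (sqrtOneSub z).re := by
  have h0 : 1 - z ≠ 0 := slitPlane_ne_zero hz
  rw [sqrtOneSub, cpow_def_of_ne_zero h0, exp_re]
  refine mul_pos (Real.exp_pos _) (Real.cos_pos_of_mem_Ioo ?_)
  have h1 : (log (1 - z) * 2⁻¹).im = arg (1 - z) / 2 := by
    rw [show (2⁻¹ : ℂ) = ((2⁻¹ : ℝ) : ℂ) by push_cast; rfl, im_mul_ofReal, log_im]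
    ring
  rw [h1]
  have h2 := neg_pi_lt_arg (1 - z)
  have h3 := (arg_le_pi (1 - z)).lt_of_ne (mem_slitPlane_iff_arg.1 hz).1
  constructor <;> linarith

theorem sqrtOneSub_ne_zero {z : ℂ} (hz : z ∈ cutPlane) : sqrtOneSub z ≠ 0 := by
  intro h
  simpa [h] using sqrtOneSub_re_pos hz

theorem sqrtOneSub_add_one_ne_zero {z : ℂ} (hz : z ∈ cutPlane) : sqrtOneSub z + 1 ≠ 0 := by
  intro h
  have h1 := congrArg Complex.re h
  have := sqrtOneSub_re_pos hz
  simp at h1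
  linarith

/-- The square root lies in the right half-plane, which `r ↦ (r-1)/(r+1)` maps to the disc. -/
theorem koebeInv_mem_ball {z : ℂ} (hz : z ∈ cutPlane) : koebeInv z ∈ Metric.ball (0 : ℂ) 1 := by
  have h1 := sqrtOneSub_re_pos hz
  have h2 := norm_pos_iff.2 (sqrtOneSub_add_one_ne_zero hz)
  rw [mem_ball_zero_iff, koebeInv, norm_div, div_lt_one h2]
  refine lt_of_pow_lt_pow_left₀ 2 h2.le ?_
  rw [Complex.sq_norm, Complex.sq_norm, normSq_apply, normSq_apply]
  simp
  nlinarith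

theorem hasDerivAt_sqrtOneSub {z : ℂ} (hz : z ∈ cutPlane) :
    HasDerivAt sqrtOneSub (-(2 * sqrtOneSub z)⁻¹) z := by
  have h := ((hasDerivAt_id z).const_sub 1).cpow_const (c := 2⁻¹) (by exact hz)
  have h0 : 1 - z ≠ 0 := slitPlane_ne_zero hz
  refine h.congr_deriv ?_
  have h2 : (1 - z) ^ ((2⁻¹ : ℂ) - 1) = sqrtOneSub z / (1 - z) := by
    rw [cpow_sub _ _ h0, cpow_one, sqrtOneSub]
  simp only [id] at *
  rw [h2, ← sqrtOneSub_sq]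
  have := sqrtOneSub_ne_zero hz
  field_simp

theorem hasDerivAt_koebeInv {z : ℂ} (hz : z ∈ cutPlane) :
    HasDerivAt koebeInv (-(sqrtOneSub z * (sqrtOneSub z + 1) ^ 2)⁻¹) z := by
  have h := hasDerivAt_sqrtOneSub hz
  have h1 := sqrtOneSub_add_one_ne_zero hz
  have h0 := sqrtOneSub_ne_zero hz
  refine ((h.sub_const 1).div (h.add_const 1) h1).congr_deriv ?_
  field_simp
  ring

/-- Since `z w' = w / r`, the Euler operator in `z` is `1/r` times the one in `w`, so the equation
of `lerch` carries over. -/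
theorem exists_hasDerivAt_lerch_koebeInv {b : ℂ} (hb : ∀ n : ℕ, (n : ℂ) + b ≠ 0) {z : ℂ}
    (hz : z ∈ cutPlane) : ∃ d, HasDerivAt (fun z => lerch b (koebeInv z)) d z ∧
      z * d = ((sqrtOneSub z + 1) / 2 - b * lerch b (koebeInv z)) / sqrtOneSub z := by
  have hw := koebeInv_mem_ball hz
  have h1 := ((differentiableOn_lerch b).differentiableAt
    (Metric.isOpen_ball.mem_nhds hw)).hasDerivAt.comp z (hasDerivAt_koebeInv hz)
  have h2 := mul_deriv_lerch hb hw
  refine ⟨_, h1, ?_⟩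
  have hr1 := sqrtOneSub_add_one_ne_zero hz
  have hr := sqrtOneSub_ne_zero hz
  have h3 : (1 - koebeInv z)⁻¹ = (sqrtOneSub z + 1) / 2 := by
    rw [koebeInv, one_sub_div hr1, inv_div]
    congr 1
    ring
  rw [← h3, ← h2]
  have h4 : z = 1 - sqrtOneSub z ^ 2 := by rw [sqrtOneSub_sq]; ring
  generalize deriv (lerch b) (koebeInv z) = d
  rw [koebeInv]
  generalize sqrtOneSub z = r at *
  rw [h4]
  field_simp
  ring

/-! ### Closed form of the `₃F₂` -/

/-- The continuation of `₃F₂(1/2, 1, 1; 1 - c, 1 + c; z)` in terms of Lerch-type series. -/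
def cont32 (c z : ℂ) : ℂ :=
  c * (lerch c (koebeInv z) - koebeInv z * lerch (1 - c) (koebeInv z)) / sqrtOneSub z

/-- The companion of `cont32` in the first-order system equivalent to its differential
equation. -/
def cont32Aux (c z : ℂ) : ℂ :=
  c * (1 - c * (lerch c (koebeInv z) + koebeInv z * lerch (1 - c) (koebeInv z)))

/-- With `θ = z d/dz`, eliminating the companion gives `(θ² - c²)F - z(θ+1)(θ+1/2)F = -c²`, the
`₃F₂` equation with one factor `θ` removed. The system form avoids second derivatives. -/
theorem cont32_system {c : ℂ} (hc : ∀ n : ℕ, (n : ℂ) + c ≠ 0)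
    (hc' : ∀ n : ℕ, (n : ℂ) + (1 - c) ≠ 0) {z : ℂ} (hz : z ∈ cutPlane) :
    DifferentiableAt ℂ (cont32 c) z ∧ DifferentiableAt ℂ (cont32Aux c) z ∧
    cont32Aux c z = z * deriv (cont32 c) z - z * (z * deriv (cont32 c) z + 1 / 2 * cont32 c z) ∧
    z * deriv (cont32Aux c) z = c ^ 2 * (cont32 c z - 1) := by
  obtain ⟨d₁, h₁, e₁⟩ := exists_hasDerivAt_lerch_koebeInv hc hz
  obtain ⟨d₂, h₂, e₂⟩ := exists_hasDerivAt_lerch_koebeInv hc' hz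
  have hw := hasDerivAt_koebeInv hz
  have hr := hasDerivAt_sqrtOneSub hz
  have hr1 := sqrtOneSub_add_one_ne_zero hz
  have hr0 := sqrtOneSub_ne_zero hz
  have hF : HasDerivAt (cont32 c) _ z := ((h₁.sub (hw.mul h₂)).const_mul c).div hr hr0
  have hK : HasDerivAt (cont32Aux c) _ z :=
    (((h₁.add (hw.mul h₂)).const_mul c).const_sub 1).const_mul c
  refine ⟨hF.differentiableAt, hK.differentiableAt, ?_, ?_⟩
  · rw [hF.deriv, cont32Aux, cont32]
    have h4 : z = 1 - sqrtOneSub z ^ 2 := by rw [sqrtOneSub_sq]; ring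
    simp only [Pi.sub_apply, Pi.mul_apply]
    generalize lerch c (koebeInv z) = A at *
    generalize lerch (1 - c) (koebeInv z) = B at *
    rw [koebeInv] at *
    generalize sqrtOneSub z = r at *
    have key : ∀ w' r' : ℂ, z * ((c * (d₁ - (w' * B + (r - 1) / (r + 1) * d₂)) * r -
        c * (A - (r - 1) / (r + 1) * B) * r') / r ^ 2) =
        (c * (z * d₁ - (z * w' * B + (r - 1) / (r + 1) * (z * d₂))) * r -
        c * (A - (r - 1) / (r + 1) * B) * (z * r')) / r ^ 2 := fun _ _ => by ring
    rw [key, e₁, e₂, h4]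
    field_simp
    ring
  · rw [hK.deriv, cont32]
    have h4 : z = 1 - sqrtOneSub z ^ 2 := by rw [sqrtOneSub_sq]; ring
    generalize lerch c (koebeInv z) = A at *
    generalize lerch (1 - c) (koebeInv z) = B at *
    rw [koebeInv] at *
    generalize sqrtOneSub z = r at *
    have key : ∀ w' : ℂ, z * (c * -(c * (d₁ + (w' * B + (r - 1) / (r + 1) * d₂)))) =
        -c ^ 2 * (z * d₁ + (z * w' * B + (r - 1) / (r + 1) * (z * d₂))) := fun _ => by ring
    rw [key, e₁, e₂, h4]
    field_simp
    ring

theorem exists_hasSum_of_differentiableOn {f : ℂ → ℂ}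
    (hf : DifferentiableOn ℂ f (Metric.ball 0 1)) :
    ∃ a : ℕ → ℂ, ∀ z ∈ Metric.ball (0 : ℂ) 1, HasSum (fun n => a n * z ^ n) (f z) := by
  refine ⟨fun n => (n.factorial : ℂ)⁻¹ * iteratedDeriv n f 0, fun z hz => ?_⟩
  refine (Complex.hasSum_taylorSeries_on_ball hf hz).congr_fun fun n => ?_
  simp only [smul_eq_mul, sub_zero]
  ring

theorem coeff32_zero (a₁ a₂ a₃ b₁ b₂ : ℂ) : coeff32 a₁ a₂ a₃ b₁ b₂ 0 = 1 := by
  simp [coeff32]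

theorem coeff32_succ {b₁ b₂ : ℂ} {n : ℕ} (h₁ : b₁ + n ≠ 0) (h₂ : b₂ + n ≠ 0) (a₁ a₂ a₃ : ℂ) :
    coeff32 a₁ a₂ a₃ b₁ b₂ (n + 1) * ((b₁ + n) * (b₂ + n) * (n + 1)) =
      coeff32 a₁ a₂ a₃ b₁ b₂ n * ((a₁ + n) * (a₂ + n) * (a₃ + n)) := by
  have h3 : (n : ℂ) + 1 ≠ 0 := n.cast_add_one_ne_zero
  simp only [coeff32, ascPochhammer_succ_eval, Nat.factorial_succ, Nat.cast_mul, Nat.cast_succ]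
  rw [div_mul_eq_mul_div, div_mul_eq_mul_div,
    show (ascPochhammer ℂ n).eval b₁ * (b₁ + n) * ((ascPochhammer ℂ n).eval b₂ * (b₂ + n)) *
      ((n + 1) * (n.factorial : ℂ)) = ((ascPochhammer ℂ n).eval b₁ * (ascPochhammer ℂ n).eval b₂ *
      (n.factorial : ℂ)) * ((b₁ + n) * (b₂ + n) * (n + 1)) by ring,
    mul_div_mul_right _ _ (mul_ne_zero (mul_ne_zero h₁ h₂) h3)]
  ring

theorem isContinuation_cont32 {c : ℂ} (hc : ∀ n : ℕ, (n : ℂ) + c ≠ 0)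
    (hc' : ∀ n : ℕ, (n : ℂ) + (1 - c) ≠ 0) :
    IsContinuation (fun z => ∑' n : ℕ, coeff32 (1 / 2) 1 1 (1 - c) (1 + c) n * z ^ n)
      (cont32 c) := by
  have hsys := fun z (hz : z ∈ cutPlane) => cont32_system hc hc' hz
  have hd : DifferentiableOn ℂ (cont32 c) cutPlane :=
    fun z hz => (hsys z hz).1.differentiableWithinAt
  have hd' : DifferentiableOn ℂ (cont32Aux c) cutPlane :=
    fun z hz => (hsys z hz).2.1.differentiableWithinAt
  refine ⟨hd.analyticOnNhd isOpen_cutPlane, ?_⟩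
  obtain ⟨a, ha⟩ := exists_hasSum_of_differentiableOn (hd.mono ball_subset_cutPlane)
  obtain ⟨b, hb⟩ := exists_hasSum_of_differentiableOn (hd'.mono ball_subset_cutPlane)
  have hB : (fun n : ℕ => (n : ℂ) * b n) = fun n => c ^ 2 * (a n - if n = 0 then 1 else 0) := by
    refine coeff_eq_of_hasSum (f := fun z => z * deriv (cont32Aux c) z)
      (fun z hz => (hasSum_mul_deriv hb hz).1) fun z hz => ?_
    rw [(hsys z (ball_subset_cutPlane hz)).2.2.2]
    have h1 : HasSum (fun n : ℕ => (if n = 0 then 1 else 0) * z ^ n) 1 := by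
      have := hasSum_ite_eq (α := ℂ) 0 (1 : ℂ)
      refine this.congr_fun fun n => ?_
      rcases n with _ | n <;> simp
    refine (((ha z hz).sub h1).mul_left (c ^ 2)).congr_fun fun n => ?_
    ring
  -- The `Nat.rec` is the coefficient sequence of `z (θ + 1/2) F`: a shift by one with 0 in degree
  -- zero.
  have hA : b = fun n => n * a n -
      Nat.rec (motive := fun _ => ℂ) 0 (fun m _ => m * a m + 1 / 2 * a m) n := by
    refine coeff_eq_of_hasSum hb fun z hz => ?_
    rw [(hsys z (ball_subset_cutPlane hz)).2.2.1]
    have h1 := (hasSum_mul_deriv ha hz).1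
    have h2 := ((h1.add ((ha z hz).mul_left (1 / 2))).mul_left z)
    have h3 : HasSum (fun n : ℕ =>
        (Nat.rec (motive := fun _ => ℂ) 0 (fun m _ => m * a m + 1 / 2 * a m) n) * z ^ n)
        (z * (z * deriv (cont32 c) z + 1 / 2 * cont32 c z)) := by
      have h4 := (hasSum_nat_add_iff (f := fun n : ℕ =>
        (Nat.rec (motive := fun _ => ℂ) 0 (fun m _ => m * a m + 1 / 2 * a m) n) * z ^ n) 1).1
        (h2.congr_fun fun n => by ring)
      simpa using h4
    refine (h1.sub h3).congr_fun fun n => ?_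
    ring
  have hcoeff : ∀ n, a n = coeff32 (1 / 2) 1 1 (1 - c) (1 + c) n := by
    have hc0 : c ≠ 0 := by simpa using hc 0
    intro n
    induction n with
    | zero =>
      have := congrFun hB 0
      simp only [CharP.cast_eq_zero, zero_mul, if_true] at this
      rw [coeff32_zero]
      have h2 := (mul_eq_zero.1 this.symm).resolve_left (pow_ne_zero 2 hc0)
      linear_combination h2
    | succ n ih =>
      have h1 := congrFun hB (n + 1)
      have h2 := congrFun hA (n + 1)
      simp only [Nat.succ_ne_zero, if_false, sub_zero] at h1
      have n1 : (1 - c) + n ≠ 0 := by rw [add_comm]; exact hc' n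
      have n2 : (1 + c) + n ≠ 0 := by
        have := hc (n + 1)
        push_cast at this
        intro h
        exact this (by linear_combination h)
      have n3 : (n : ℂ) + 1 ≠ 0 := n.cast_add_one_ne_zero
      have h3 := coeff32_succ n1 n2 (1 / 2) 1 1
      rw [← ih] at h3
      rw [h2] at h1
      refine mul_right_cancel₀ (mul_ne_zero (mul_ne_zero n1 n2) n3) ?_
      rw [h3]
      push_cast at h1
      -- The system yields the recursion with one factor `n + 1` fewer than `coeff32_succ`.
      linear_combination (n + 1) * h1
  intro z hz
  have := (ha z hz).tsum_eq
  simp only [hcoeff] at this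
  exact this.symm

theorem F32_eq_cont32 {c : ℂ} (hc : ∀ n : ℕ, (n : ℂ) + c ≠ 0)
    (hc' : ∀ n : ℕ, (n : ℂ) + (1 - c) ≠ 0) {z : ℂ} (hz : z ∈ cutPlane) :
    F32 (1 / 2) 1 1 (1 - c) (1 + c) z = cont32 c z :=
  (isContinuation_cont32 hc hc').principalValue_eq hz

/-- `termA` in terms of Lerch-type series in `y²`. -/
theorem termA_eq {k : ℂ} (hk : ∀ n : ℕ, (n : ℂ) + (1 + k) / 2 ≠ 0)
    (hk' : ∀ n : ℕ, (n : ℂ) + (1 - k) / 2 ≠ 0) {y : ℝ} (hy0 : 0 < y) (hy1 : y < 1) :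
    termA k y = (y : ℂ) ^ 2 / (1 - (y : ℂ) ^ 4) *
      (lerch ((1 + k) / 2) ((y : ℂ) ^ 2) - (y : ℂ) ^ 2 * lerch ((1 - k) / 2) ((y : ℂ) ^ 2)) := by
  have hy2 : y ^ 2 < 1 := pow_lt_one₀ hy0.le hy1 two_ne_zero
  have hyC : (y : ℂ) ≠ 0 := by exact_mod_cast hy0.ne'
  have h1 : (1 : ℂ) - (y : ℂ) ^ 2 ≠ 0 := by exact_mod_cast (sub_pos.2 hy2).ne'
  have h2 : (1 : ℂ) + (y : ℂ) ^ 2 ≠ 0 := by exact_mod_cast (by positivity : (1 : ℝ) + y ^ 2 ≠ 0)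
  have h3 : (1 : ℂ) - (y : ℂ) ^ 4 ≠ 0 := by
    rw [show (1 : ℂ) - (y : ℂ) ^ 4 = (1 - (y : ℂ) ^ 2) * (1 + (y : ℂ) ^ 2) by ring]
    exact mul_ne_zero h1 h2
  have hk1 : k + 1 ≠ 0 := by
    intro h
    have := hk 0
    rw [add_comm, h] at hk
    simp at hk
  have hyy : (y : ℂ) - (y : ℂ)⁻¹ ≠ 0 := by
    rw [show (y : ℂ) - (y : ℂ)⁻¹ = -(1 - (y : ℂ) ^ 2) / y by field_simp; ring]
    exact div_ne_zero (neg_ne_zero.2 h1) hyC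
  set z : ℂ := -4 / ((y : ℂ) - (y : ℂ)⁻¹) ^ 2 with hz
  -- This is the square root of `1 - z`; it makes the Koebe variable equal to `y²`.
  set r : ℝ := (1 + y ^ 2) / (1 - y ^ 2) with hr
  have hrpos : 0 < r := div_pos (by positivity) (sub_pos.2 hy2)
  have hrC : (r : ℂ) = (1 + (y : ℂ) ^ 2) / (1 - (y : ℂ) ^ 2) := by rw [hr]; push_cast; rfl
  have hzr : 1 - z = (r : ℂ) ^ 2 := by
    rw [hz, hrC, show (y : ℂ) - (y : ℂ)⁻¹ = -(1 - (y : ℂ) ^ 2) / y by field_simp; ring]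
    field_simp
    ring
  have hzc : z ∈ cutPlane := by
    change 1 - z ∈ slitPlane
    rw [hzr]
    exact Or.inl (by rw [← ofReal_pow, ofReal_re]; positivity)
  have hs : sqrtOneSub z = r := by
    rw [sqrtOneSub, hzr]
    exact Complex.sq_cpow_two_inv (by simpa using hrpos)
  have hw : koebeInv z = (y : ℂ) ^ 2 := by
    have : 1 + (y : ℂ) ^ 2 + (1 - (y : ℂ) ^ 2) ≠ 0 := by ring_nf; norm_num
    rw [koebeInv, hs, hrC]
    field_simp
    ring
  have e := F32_eq_cont32 (c := (1 + k) / 2) hk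
    (by rwa [show (1 : ℂ) - (1 + k) / 2 = (1 - k) / 2 by ring]) hzc
  rw [show (1 : ℂ) - (1 + k) / 2 = (1 - k) / 2 by ring,
    show (1 : ℂ) + (1 + k) / 2 = (3 + k) / 2 by ring] at e
  rw [termA, e, cont32, hs, hw, hrC, show (1 : ℂ) - (1 + k) / 2 = (1 - k) / 2 by ring,
    show (y : ℂ) - (y : ℂ)⁻¹ = -(1 - (y : ℂ) ^ 2) / y by field_simp; ring,
    show (1 : ℂ) - (y : ℂ) ^ 4 = (1 - (y : ℂ) ^ 2) * (1 + (y : ℂ) ^ 2) by ring]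
  generalize lerch ((1 + k) / 2) ((y : ℂ) ^ 2) = A
  generalize lerch ((1 - k) / 2) ((y : ℂ) ^ 2) = B
  field_simp
  ring

/-! ### Euler's integral as continuation of the Lerch series -/

/-- Euler's integral `∫₀¹ t^(b-1) / (1 - zt) dt`, the continuation of `lerch b` to the cut plane
when `0 < Re b`. -/
def lerchCont (b z : ℂ) : ℂ := ∫ t in (0 : ℝ)..1, (t : ℂ) ^ (b - 1) * (1 - z * t)⁻¹

theorem one_sub_mul_ne_zero {z : ℂ} (hz : z ∈ cutPlane) {t : ℝ} (ht : t ∈ Set.Icc (0 : ℝ) 1) :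
    1 - z * t ≠ 0 := by
  intro h
  have ht0 : t ≠ 0 := by rintro rfl; simp at h
  have htp : 0 < t := lt_of_le_of_ne ht.1 ht0.symm
  have hz' : z = ((t⁻¹ : ℝ) : ℂ) := by
    have : (t : ℂ) ≠ 0 := by exact_mod_cast ht0
    push_cast
    field_simp
    linear_combination -h
  rw [hz'] at hz
  have h2 : (1 : ℝ) ≤ t⁻¹ := (one_le_inv₀ htp).2 ht.2
  rcases hz with hz | hz
  · simp only [sub_re, one_re, ofReal_re] at hz
    linarith
  · simp at hz

theorem intervalIntegrable_cpow_mul {b : ℂ} (hb : 0 < b.re) {f : ℝ → ℂ}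
    (hf : ContinuousOn f (Set.Icc 0 1)) :
    IntervalIntegrable (fun t : ℝ => (t : ℂ) ^ (b - 1) * f t) MeasureTheory.volume 0 1 := by
  refine (intervalIntegral.intervalIntegrable_cpow' (r := b - 1) ?_).mul_continuousOn ?_
  · simpa using hb
  · rwa [Set.uIcc_of_le zero_le_one]

/-- Half the minimum over the compact segment survives a perturbation of `z` smaller than that half.
The uniform bound dominates the integrand's derivative in `w`. -/
theorem exists_pos_le_norm_one_sub_mul {z : ℂ} (hz : z ∈ cutPlane) :
    ∃ δ > 0, ∀ w ∈ Metric.ball z δ, ∀ t ∈ Set.Icc (0 : ℝ) 1, δ ≤ ‖1 - w * t‖ := by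
  obtain ⟨t₀, ht₀, hmin⟩ := isCompact_Icc.exists_isMinOn (Set.nonempty_Icc.2 zero_le_one)
    (f := fun t : ℝ => ‖1 - z * t‖) (by fun_prop)
  have hpos : 0 < ‖1 - z * t₀‖ := norm_pos_iff.2 (one_sub_mul_ne_zero hz ht₀)
  refine ⟨‖1 - z * t₀‖ / 2, half_pos hpos, fun w hw t ht => ?_⟩
  have h1 : ‖1 - z * t₀‖ ≤ ‖1 - z * t‖ := hmin ht
  have h2 : ‖(1 - z * t) - (1 - w * t)‖ ≤ ‖w - z‖ := by
    rw [show (1 - z * t) - (1 - w * t) = (w - z) * (t : ℂ) by ring, norm_mul, norm_real,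
      Real.norm_of_nonneg ht.1]
    exact mul_le_of_le_one_right (norm_nonneg _) ht.2
  have h3 := norm_sub_norm_le (1 - z * t) (1 - w * t)
  have h4 := mem_ball_iff_norm.1 hw
  linarith

theorem differentiableOn_lerchCont {b : ℂ} (hb : 0 < b.re) :
    DifferentiableOn ℂ (lerchCont b) cutPlane := by
  intro z hz
  obtain ⟨δ, hδ, hle⟩ := exists_pos_le_norm_one_sub_mul hz
  have hne : ∀ w ∈ Metric.ball z δ, ∀ t ∈ Set.Icc (0 : ℝ) 1, 1 - w * (t : ℂ) ≠ 0 :=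
    fun w hw t ht => norm_pos_iff.1 (hδ.trans_le (hle w hw t ht))
  have hint : ∀ w ∈ Metric.ball z δ, IntervalIntegrable
      (fun t : ℝ => (t : ℂ) ^ (b - 1) * (1 - w * t)⁻¹) MeasureTheory.volume 0 1 := fun w hw =>
    intervalIntegrable_cpow_mul hb
      (ContinuousOn.inv₀ (by fun_prop) fun t ht => hne w hw t ht)
  have hint' : IntervalIntegrable (fun t : ℝ => (t : ℂ) ^ (b - 1) * (t / (1 - z * t) ^ 2))
      MeasureTheory.volume 0 1 :=
    intervalIntegrable_cpow_mul hb (ContinuousOn.div (by fun_prop) (by fun_prop)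
      fun t ht => pow_ne_zero 2 (hne z (Metric.mem_ball_self hδ) t ht))
  have h := intervalIntegral.hasDerivAt_integral_of_dominated_loc_of_deriv_le
    (𝕜 := ℂ) (μ := MeasureTheory.volume) (a := 0) (b := 1) (x₀ := z)
    (F := fun w t => (t : ℂ) ^ (b - 1) * (1 - w * t)⁻¹)
    (F' := fun w t => (t : ℂ) ^ (b - 1) * (t / (1 - w * t) ^ 2))
    (bound := fun t => ‖(t : ℂ) ^ (b - 1)‖ * (1 / δ ^ 2))
    (Metric.ball_mem_nhds z hδ) ?_ (hint z (Metric.mem_ball_self hδ)) ?_ ?_ ?_ ?_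
  · exact h.2.differentiableAt.differentiableWithinAt
  · filter_upwards [Metric.ball_mem_nhds z hδ] with w hw
    exact (intervalIntegrable_iff.1 (hint w hw)).aestronglyMeasurable
  · exact (intervalIntegrable_iff.1 hint').aestronglyMeasurable
  · refine Eventually.of_forall fun t ht w hw => ?_
    rw [Set.uIoc_of_le zero_le_one] at ht
    have ht' : t ∈ Set.Icc (0 : ℝ) 1 := ⟨ht.1.le, ht.2⟩
    rw [norm_mul, norm_div, norm_pow, norm_real, Real.norm_of_nonneg ht'.1]
    gcongr
    · exact ht'.2
    · exact hle w hw t ht'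
  · exact (intervalIntegral.intervalIntegrable_cpow' (r := b - 1) (by simpa using hb)).norm.mul_const _
  · refine Eventually.of_forall fun t ht w hw => ?_
    rw [Set.uIoc_of_le zero_le_one] at ht
    have hn := hne w hw t ⟨ht.1.le, ht.2⟩
    have h1 : HasDerivAt (fun w : ℂ => 1 - w * (t : ℂ)) (-(t : ℂ)) w := by
      simpa using ((hasDerivAt_id w).mul_const (t : ℂ)).const_sub 1
    refine ((h1.inv hn).const_mul _).congr_deriv ?_
    rw [neg_neg]

/-- Expand `1/(1 - zt)` as a geometric series and integrate termwise; `‖t^(b-1)‖ ‖z‖ⁿ` dominates. -/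
theorem lerchCont_eqOn {b : ℂ} (hb : 0 < b.re) :
    Set.EqOn (lerchCont b) (lerch b) (Metric.ball 0 1) := by
  intro z hz
  have hz1 := mem_ball_zero_iff.1 hz
  have hb' : -1 < (b - 1).re := by simpa using hb
  have hci : IntervalIntegrable (fun t : ℝ => (t : ℂ) ^ (b - 1)) MeasureTheory.volume 0 1 :=
    intervalIntegral.intervalIntegrable_cpow' hb'
  have hint : ∀ n : ℕ, IntervalIntegrable (fun t : ℝ => (t : ℂ) ^ (b - 1) * (z * t) ^ n)
      MeasureTheory.volume 0 1 := fun n => intervalIntegrable_cpow_mul hb (by fun_prop)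
  have hval : ∀ n : ℕ, ∫ t in (0 : ℝ)..1, (t : ℂ) ^ (b - 1) * (z * t) ^ n =
      ((n : ℂ) + b)⁻¹ * z ^ n := by
    intro n
    have hr : -1 < (b - 1 + n).re := by
      have := n.cast_nonneg (α := ℝ)
      simp
      linarith
    have h1 : ∀ t ∈ Set.uIoc (0 : ℝ) 1, (t : ℂ) ^ (b - 1) * (z * t) ^ n =
        z ^ n * (t : ℂ) ^ (b - 1 + n) := by
      intro t ht
      rw [Set.uIoc_of_le zero_le_one] at ht
      have : (t : ℂ) ≠ 0 := by exact_mod_cast ht.1.ne'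
      rw [cpow_add _ _ this, cpow_natCast]
      ring
    have hne : b - 1 + n + 1 ≠ 0 := by
      intro h
      have := congrArg Complex.re h
      simp at this hr
      linarith
    rw [intervalIntegral.integral_congr_ae (Eventually.of_forall h1), intervalIntegral.integral_const_mul,
      integral_cpow (Or.inl hr)]
    rw [ofReal_one, one_cpow, ofReal_zero, zero_cpow hne, sub_zero, mul_comm, one_div]
    congr 2
    ring
  simp only [intervalIntegral.integral_of_le zero_le_one] at hval
  have hsum := MeasureTheory.hasSum_integral_of_summable_integral_norm
    (μ := MeasureTheory.volume.restrict (Set.Ioc (0 : ℝ) 1))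
    (F := fun (n : ℕ) (t : ℝ) => (t : ℂ) ^ (b - 1) * (z * t) ^ n)
    (fun n => (intervalIntegrable_iff_integrableOn_Ioc_of_le zero_le_one).1 (hint n)) ?_
  · simp only [hval] at hsum
    rw [lerchCont, intervalIntegral.integral_of_le zero_le_one, (hasSum_lerch b hz).unique hsum]
    refine MeasureTheory.setIntegral_congr_fun measurableSet_Ioc fun t ht => ?_
    have hzt : ‖z * (t : ℂ)‖ < 1 := by
      rw [norm_mul, norm_real, Real.norm_of_nonneg ht.1.le]
      exact (mul_le_of_le_one_right (norm_nonneg _) ht.2).trans_lt hz1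
    simp only [tsum_mul_left, tsum_geometric_of_norm_lt_one hzt]
  · refine Summable.of_nonneg_of_le (fun n => MeasureTheory.integral_nonneg fun t => norm_nonneg _)
      (fun n => ?_) ((summable_geometric_of_lt_one (norm_nonneg z) hz1).mul_left
        (∫ t in Set.Ioc (0 : ℝ) 1, ‖(t : ℂ) ^ (b - 1)‖))
    rw [← MeasureTheory.integral_mul_const]
    have hI := fun {f : ℝ → ℂ} => intervalIntegrable_iff_integrableOn_Ioc_of_le (f := f)
      (μ := MeasureTheory.volume) zero_le_one
    refine MeasureTheory.setIntegral_mono_on (hI.1 (hint n)).norm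
      ((hI.1 hci).norm.mul_const _) measurableSet_Ioc fun t ht => ?_
    rw [norm_mul, norm_pow, norm_mul, norm_real, Real.norm_of_nonneg ht.1.le]
    have := mul_nonneg (norm_nonneg z) ht.1.le
    gcongr
    exact mul_le_of_le_one_right (norm_nonneg _) ht.2

theorem natCast_add_ne_zero {b : ℂ} (hb : 0 < b.re) (n : ℕ) : (n : ℂ) + b ≠ 0 := by
  intro h
  have := congrArg Complex.re h
  simp only [add_re, natCast_re, zero_re] at this
  linarith [n.cast_nonneg (α := ℝ)]

theorem mem_cutPlane_of_im_ne_zero {z : ℂ} (hz : z.im ≠ 0) : z ∈ cutPlane :=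
  Or.inr (by simpa using hz)

theorem one_sub_ne_zero_of_mem_cutPlane {z : ℂ} (hz : z ∈ cutPlane) : 1 - z ≠ 0 :=
  slitPlane_ne_zero hz

theorem differentiableAt_lerchCont {b : ℂ} (hb : 0 < b.re) {z : ℂ} (hz : z ∈ cutPlane) :
    DifferentiableAt ℂ (lerchCont b) z :=
  (differentiableOn_lerchCont hb).differentiableAt (isOpen_cutPlane.mem_nhds hz)

theorem mul_deriv_lerchCont {b : ℂ} (hb : 0 < b.re) {z : ℂ} (hz : z ∈ cutPlane) :
    z * deriv (lerchCont b) z = (1 - z)⁻¹ - b * lerchCont b z := by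
  have hd := differentiableOn_lerchCont hb
  refine eqOn_cutPlane_of_eqOn_ball (f := fun z => z * deriv (lerchCont b) z)
    (g := fun z => (1 - z)⁻¹ - b * lerchCont b z) (differentiableOn_id.mul (hd.deriv isOpen_cutPlane))
    (DifferentiableOn.sub (DifferentiableOn.inv (by fun_prop)
      fun z hz => one_sub_ne_zero_of_mem_cutPlane hz) (hd.const_mul b)) ?_ hz
  intro w hw
  have h1 : deriv (lerchCont b) w = deriv (lerch b) w := Filter.EventuallyEq.deriv_eq <|
    (lerchCont_eqOn hb).eventuallyEq_of_mem (Metric.isOpen_ball.mem_nhds hw)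
  change w * deriv (lerchCont b) w = _ - b * lerchCont b w
  rw [h1, lerchCont_eqOn hb hw, mul_deriv_lerch (natCast_add_ne_zero hb) hw]

theorem lerch_eq_inv_add (b : ℂ) {z : ℂ} (hz : z ∈ Metric.ball (0 : ℂ) 1) :
    lerch b z = b⁻¹ + z * lerch (b + 1) z := by
  have h1 := (hasSum_nat_add_iff (f := fun n : ℕ => ((n : ℂ) + b)⁻¹ * z ^ n) 1).1
    (((hasSum_lerch (b + 1) hz).mul_left z).congr_fun fun n => by
      push_cast
      rw [show (n : ℂ) + 1 + b = n + (b + 1) by ring]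
      ring)
  refine (hasSum_lerch b hz).unique ?_
  simpa [add_comm] using h1

theorem lerchCont_eq_inv_add {b : ℂ} (hb : 0 < b.re) {z : ℂ} (hz : z ∈ cutPlane) :
    lerchCont b z = b⁻¹ + z * lerchCont (b + 1) z := by
  have hb1 : 0 < (b + 1).re := by
    rw [add_re, one_re]
    linarith
  refine eqOn_cutPlane_of_eqOn_ball (g := fun z => b⁻¹ + z * lerchCont (b + 1) z)
    (differentiableOn_lerchCont hb)
    ((differentiableOn_id.mul (differentiableOn_lerchCont hb1)).const_add _) ?_ hz
  intro w hw
  change lerchCont b w = b⁻¹ + w * lerchCont (b + 1) w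
  rw [lerchCont_eqOn hb hw, lerchCont_eqOn hb1 hw, lerch_eq_inv_add b hw]

/-! ### The `₂F₁` through Euler's integral -/

/-- The coefficients are `k/(k+n)`. Splitting off the constant term shifts the parameter to `k + 1`,
so the integral converges for `Re k > -1`, and `k = 0` is harmless. -/
theorem isContinuation_lerchCont {k : ℂ} (hk : -1 < k.re) :
    IsContinuation (fun w => ordinaryHypergeometric 1 k (k + 1) w)
      (fun z => 1 + k * z * lerchCont (k + 1) z) := by
  have hb : 0 < (k + 1).re := by
    rw [add_re, one_re]
    linarith
  have hd : DifferentiableOn ℂ (fun z => 1 + k * z * lerchCont (k + 1) z) cutPlane :=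
    ((differentiableOn_id.const_mul k).mul (differentiableOn_lerchCont hb)).const_add 1
  refine ⟨hd.analyticOnNhd isOpen_cutPlane, fun z hz => ?_⟩
  change 1 + k * z * lerchCont (k + 1) z = _
  have hp : ∀ n : ℕ, (ascPochhammer ℂ n).eval (k + 1) ≠ 0 := by
    intro n
    rw [Ne, ascPochhammer_eval_eq_zero_iff]
    rintro ⟨m, -, hm⟩
    exact natCast_add_ne_zero hb m (by rw [hm]; ring)
  rw [lerchCont_eqOn hb hz, ordinaryHypergeometric_eq_tsum]
  have h1 := (hasSum_nat_add_iff (f := fun n : ℕ => ((n.factorial : ℂ)⁻¹ *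
      (ascPochhammer ℂ n).eval 1 * (ascPochhammer ℂ n).eval k *
      ((ascPochhammer ℂ n).eval (k + 1))⁻¹) • z ^ n) 1).1
    (((hasSum_lerch (k + 1) hz).mul_left (k * z)).congr_fun fun n => by
      have h2 : (ascPochhammer ℂ (n + 1)).eval k = k * (ascPochhammer ℂ n).eval (k + 1) := by
        simp [ascPochhammer_succ_left]
      have h3 : (((n + 1).factorial : ℕ) : ℂ) ≠ 0 := by exact_mod_cast (n + 1).factorial_ne_zero
      have h4 := natCast_add_ne_zero hb n
      have h5 : k + 1 + n ≠ 0 := by rwa [add_comm]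
      have h6 := hp n
      rw [h2, ascPochhammer_succ_eval n (k + 1), ascPochhammer_eval_one, smul_eq_mul]
      field_simp
      ring)
  beta_reduce
  rw [h1.tsum_eq]
  simp [add_comm]

theorem F21_eq {k : ℂ} (hk : -1 < k.re) {z : ℂ} (hz : z ∈ cutPlane) :
    F21 1 k (k + 1) z = 1 + k * z * lerchCont (k + 1) z :=
  (isContinuation_lerchCont hk).principalValue_eq hz

/-! ### One-sided limits on the cut -/

theorem neBot_nhdsWithin_im_neg (x : ℝ) : (𝓝[{w : ℂ | w.im < 0}] (x : ℂ)).NeBot := by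
  rw [← mem_closure_iff_nhdsWithin_neBot, Complex.closure_setOfPred_im_lt]
  simp

theorem neBot_nhdsWithin_im_pos (x : ℝ) : (𝓝[{w : ℂ | 0 < w.im}] (x : ℂ)).NeBot := by
  rw [← mem_closure_iff_nhdsWithin_neBot, Complex.closure_setOfPred_lt_im]
  simp

theorem F21_eq_of_tendsto {k : ℂ} (hk : -1 < k.re) {x : ℝ} (hx : 1 < x) {ℓ : ℂ}
    (hℓ : Tendsto (lerchCont (k + 1)) (𝓝[{w : ℂ | w.im < 0}] (x : ℂ)) (𝓝 ℓ)) :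
    F21 1 k (k + 1) x = 1 + k * x * ℓ := by
  have hnot : (x : ℂ) ∉ cutPlane := by
    rintro (h | h)
    · simp only [sub_re, one_re, ofReal_re] at h
      linarith
    · simp at h
  have := neBot_nhdsWithin_im_neg x
  rw [F21, principalValue, if_neg hnot]
  refine Tendsto.limUnder_eq ?_
  have h1 : Tendsto (fun z => 1 + k * z * lerchCont (k + 1) z)
      (𝓝[{w : ℂ | w.im < 0}] (x : ℂ)) (𝓝 (1 + k * x * ℓ)) :=
    (((tendsto_id.mono_left nhdsWithin_le_nhds).const_mul k).mul hℓ).const_add 1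
  refine h1.congr' ?_
  filter_upwards [self_mem_nhdsWithin] with w hw
  exact ((isContinuation_lerchCont hk).continuation_eqOn
    (mem_cutPlane_of_im_ne_zero (ne_of_lt hw))).symm

/-- Near the cut, `z ^ b * lerchCont b z` is `-log (1 - z)` up to an analytic function. -/
theorem exists_lerchCont_eq_sub_log {b : ℂ} (hb : 0 < b.re) {x : ℝ} (hx : 1 < x) :
    ∃ P : ℂ → ℂ, ContinuousAt P x ∧ ∀ z ∈ Metric.ball (x : ℂ) x ∩ cutPlane,
      z ^ b * lerchCont b z = P z - log (1 - z) := by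
  have hxpos : 0 < x := one_pos.trans hx
  set U := Metric.ball (x : ℂ) x with hU
  have hUre : ∀ z ∈ U, 0 < z.re := by
    intro z hz
    have h1 := (Complex.abs_re_le_norm (z - x)).trans_lt (mem_ball_iff_norm.1 hz)
    rw [sub_re, ofReal_re] at h1
    linarith [neg_lt_of_abs_lt h1]
  have hslit : ∀ z ∈ U, z ∈ slitPlane := fun z hz => Or.inl (hUre z hz)
  have hbase : ∀ s : ℝ, 0 < s → s ≤ 1 → (s : ℂ) ∈ U := by
    intro s h0 h1
    rw [hU, mem_ball_iff_norm, ← ofReal_sub, norm_real, Real.norm_eq_abs, abs_lt]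
    constructor <;> linarith
  have h1U : (1 : ℂ) ∈ U := by exact_mod_cast hbase 1 one_pos le_rfl
  have hpow : DifferentiableOn ℂ (fun z : ℂ => z ^ (b - 1)) U := fun z hz =>
    ((hasDerivAt_id z).cpow_const (hslit z hz)).differentiableAt.differentiableWithinAt
  -- `Q` is a primitive of `(z^(b-1) - 1)/(z - 1)` on a ball that contains `1` and `x` but not `0`;
  -- `dslope` fills the removable singularity at `1`.
  obtain ⟨Q, hQ⟩ := ((Complex.differentiableOn_dslope
    (Metric.isOpen_ball.mem_nhds h1U)).2 hpow).isExactOn_ball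
  have hV : IsOpen (U ∩ cutPlane) := Metric.isOpen_ball.inter isOpen_cutPlane
  have hVc : IsPreconnected (U ∩ cutPlane) := by
    have hhalf : ((1 / 2 : ℝ) : ℂ) ∈ U := hbase _ (by norm_num) (by norm_num)
    have hcut : StarConvex ℝ ((1 / 2 : ℝ) : ℂ) cutPlane := by
      intro z hz a c ha hc hac
      have h := starConvex_ofReal_slitPlane (x := 1 / 2) (by norm_num) hz ha hc hac
      have e : 1 - (a • ((1 / 2 : ℝ) : ℂ) + c • z) =
          a • ((1 / 2 : ℝ) : ℂ) + c • (1 - z) := by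
        have : (a : ℂ) + c = 1 := by exact_mod_cast hac
        simp only [real_smul]
        push_cast
        linear_combination -this
      change 1 - (a • ((1 / 2 : ℝ) : ℂ) + c • z) ∈ slitPlane
      rw [e]
      exact h
    have hmem : ((1 / 2 : ℝ) : ℂ) ∈ cutPlane := by
      refine Or.inl ?_
      rw [sub_re, one_re, ofReal_re]
      norm_num
    exact (((convex_ball (x : ℂ) x).starConvex hhalf).inter hcut).isPathConnected
      ⟨hhalf, hmem⟩ |>.isConnected.isPreconnected
  -- The derivative of `z^b Λ(b, z)` is `z^(b-1)/(1-z)`; adding `log (1-z)` leaves `-Q'`.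
  have hder : ∀ z ∈ U ∩ cutPlane,
      HasDerivAt (fun z => z ^ b * lerchCont b z + log (1 - z) + Q z) 0 z := by
    rintro z ⟨hzU, hzc⟩
    have hz0 : z ≠ 0 := slitPlane_ne_zero (hslit z hzU)
    have h1z := one_sub_ne_zero_of_mem_cutPlane hzc
    have hz1 : z ≠ 1 := by
      rintro rfl
      simp at h1z
    have hp := (hasDerivAt_id z).cpow_const (c := b) (hslit z hzU)
    have hL := (differentiableAt_lerchCont hb hzc).hasDerivAt
    have hlog := ((hasDerivAt_id z).const_sub 1).clog (by exact hzc)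
    refine (((hp.mul hL).add hlog).add (hQ z hzU)).congr_deriv ?_
    have e := mul_deriv_lerchCont hb hzc
    rw [dslope_of_ne _ hz1, slope_def_field, one_cpow]
    have e2 : z ^ b = z ^ (b - 1) * z := by
      rw [cpow_sub _ _ hz0, cpow_one]
      field_simp
    simp only [id]
    have hz1' : z - 1 ≠ 0 := sub_ne_zero.2 hz1
    have e3 : z ^ b * deriv (lerchCont b) z = z ^ (b - 1) * ((1 - z)⁻¹ - b * lerchCont b z) := by
      rw [e2, ← e]
      ring
    rw [e3]
    have e4 : (1 - z)⁻¹ = -(z - 1)⁻¹ := by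
      rw [← neg_sub, inv_neg]
    rw [div_eq_mul_inv, div_eq_mul_inv, e4]
    ring
  obtain ⟨C, hC⟩ := hV.exists_is_const_of_deriv_eq_zero hVc
    (fun z hz => (hder z hz).differentiableAt.differentiableWithinAt) fun z hz => (hder z hz).deriv
  refine ⟨fun z => C - Q z, ?_, fun z hz => ?_⟩
  · exact continuousAt_const.sub (hQ x (Metric.mem_ball_self hxpos)).continuousAt
  · linear_combination hC z hz

/-- The one-sided limits of `lerchCont b` on the cut, and their difference. -/
theorem exists_tendsto_lerchCont {b : ℂ} (hb : 0 < b.re) {x : ℝ} (hx : 1 < x) :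
    ∃ ℓ : ℂ, Tendsto (lerchCont b) (𝓝[{w : ℂ | w.im < 0}] (x : ℂ)) (𝓝 ℓ) ∧
      Tendsto (lerchCont b) (𝓝[{w : ℂ | 0 < w.im}] (x : ℂ))
        (𝓝 (ℓ + 2 * Real.pi * I * (x : ℂ) ^ (-b))) := by
  obtain ⟨P, hP, h⟩ := exists_lerchCont_eq_sub_log hb hx
  have hxpos : 0 < x := one_pos.trans hx
  have hxs : (x : ℂ) ∈ slitPlane := Or.inl (by simpa using hxpos)
  have hU : Metric.ball (x : ℂ) x ∈ 𝓝 (x : ℂ) := Metric.ball_mem_nhds _ hxpos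
  have hre : (1 - (x : ℂ)).re < 0 := by
    rw [sub_re, one_re, ofReal_re]
    linarith
  have him : (1 - (x : ℂ)).im = 0 := by simp
  have hsub : ∀ s : Set ℂ, Tendsto (fun z : ℂ => 1 - z) (𝓝[s] (x : ℂ)) (𝓝 (1 - (x : ℂ))) :=
    fun s => (tendsto_id.mono_left nhdsWithin_le_nhds).const_sub 1
  have key : ∀ (s : Set ℂ) (m : ℂ), (∀ z ∈ s, z.im ≠ 0) →
      Tendsto (fun z => log (1 - z)) (𝓝[s] (x : ℂ)) (𝓝 m) →
      Tendsto (lerchCont b) (𝓝[s] (x : ℂ)) (𝓝 ((x : ℂ) ^ (-b) * (P x - m))) := by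
    intro s m hs hm
    have hpow : Tendsto (fun z : ℂ => z ^ (-b)) (𝓝[s] (x : ℂ)) (𝓝 ((x : ℂ) ^ (-b))) :=
      ((hasDerivAt_id (x : ℂ)).cpow_const hxs).continuousAt.tendsto.mono_left nhdsWithin_le_nhds
    refine (hpow.mul ((hP.tendsto.mono_left nhdsWithin_le_nhds).sub hm)).congr' ?_
    filter_upwards [self_mem_nhdsWithin, nhdsWithin_le_nhds hU] with z hz hzU
    have hz0 : z ≠ 0 := by
      rintro rfl
      exact hs _ hz rfl
    rw [← h z ⟨hzU, mem_cutPlane_of_im_ne_zero (hs z hz)⟩, ← mul_assoc, ← cpow_add _ _ hz0,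
      neg_add_cancel, cpow_zero, one_mul]
  -- Below the cut `1 - z` lies above the negative axis, so its logarithm tends to the value with
  -- `+πi`; from above it is `-πi`.
  refine ⟨_, key _ (Real.log ‖1 - (x : ℂ)‖ + Real.pi * I) (fun z hz => ne_of_lt hz) ?_, ?_⟩
  · refine (tendsto_log_nhdsWithin_im_nonneg_of_re_neg_of_im_zero hre him).comp
      (tendsto_nhdsWithin_iff.2 ⟨hsub _, ?_⟩)
    filter_upwards [self_mem_nhdsWithin] with z hz
    have : z.im < 0 := hz
    simpa using this.le
  · have := key {w : ℂ | 0 < w.im} (Real.log ‖1 - (x : ℂ)‖ - Real.pi * I)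
      (fun z hz => ne_of_gt hz) ?_
    · convert this using 2
      ring
    · refine (tendsto_log_nhdsWithin_im_neg_of_re_neg_of_im_zero hre him).comp
        (tendsto_nhdsWithin_iff.2 ⟨hsub _, ?_⟩)
      filter_upwards [self_mem_nhdsWithin] with z hz
      have : 0 < z.im := hz
      simpa using this

/-! ### The connection formula between `u` and `u⁻¹` -/

/-- The odd part of the continued Lerch series at the reciprocal argument. -/
def oddRecip (k u : ℂ) : ℂ := u⁻¹ * (lerchCont (k + 1) u⁻¹ + lerchCont (k + 1) (-u⁻¹))

/-- The expansion at infinity that matches `oddRecip` up to a power of `u`. -/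
def oddSeries (k u : ℂ) : ℂ := u * lerch ((1 - k) / 2) (u ^ 2)

theorem sq_mem_ball {u : ℂ} (hu : u ∈ Metric.ball (0 : ℂ) 1) : u ^ 2 ∈ Metric.ball (0 : ℂ) 1 := by
  rw [mem_ball_zero_iff, norm_pow]
  exact pow_lt_one₀ (norm_nonneg u) (mem_ball_zero_iff.1 hu) two_ne_zero

theorem continuousAt_oddSeries (k : ℂ) {u : ℂ} (hu : u ∈ Metric.ball (0 : ℂ) 1) :
    ContinuousAt (oddSeries k) u := by
  have h : ContinuousAt (lerch ((1 - k) / 2)) (u ^ 2) := ((differentiableOn_lerch _).differentiableAt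
    (Metric.isOpen_ball.mem_nhds (sq_mem_ball hu))).continuousAt
  exact continuousAt_id.mul (ContinuousAt.comp (f := fun u : ℂ => u ^ 2) h (by fun_prop))

theorem exists_hasDerivAt_oddSeries {k : ℂ} (hk : ∀ n : ℕ, (n : ℂ) + (1 - k) / 2 ≠ 0) {u : ℂ}
    (hu : u ∈ Metric.ball (0 : ℂ) 1) :
    ∃ d, HasDerivAt (oddSeries k) d u ∧ u * d = 2 * u * (1 - u ^ 2)⁻¹ + k * oddSeries k u := by
  have h : HasDerivAt (lerch ((1 - k) / 2)) _ (u ^ 2) :=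
    ((differentiableOn_lerch _).differentiableAt
      (Metric.isOpen_ball.mem_nhds (sq_mem_ball hu))).hasDerivAt
  have h1 : HasDerivAt (fun u : ℂ => lerch ((1 - k) / 2) (u ^ 2)) _ u :=
    HasDerivAt.comp (h := fun u : ℂ => u ^ 2) u h (hasDerivAt_pow 2 u)
  refine ⟨_, (hasDerivAt_id u).mul h1, ?_⟩
  have e := mul_deriv_lerch hk (sq_mem_ball hu)
  simp only [oddSeries, id]
  push_cast
  linear_combination 2 * u * e

/-- The equation is the one satisfied by `oddSeries`. For non-real `u` both `u⁻¹` and `-u⁻¹` avoid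
the cut. -/
theorem exists_hasDerivAt_oddRecip {k : ℂ} (hk : -1 < k.re) {u : ℂ} (hu : u.im ≠ 0) :
    ∃ d, HasDerivAt (oddRecip k) d u ∧ u * d = 2 * u * (1 - u ^ 2)⁻¹ + k * oddRecip k u := by
  have hb : 0 < (k + 1).re := by
    rw [add_re, one_re]
    linarith
  have hu0 : u ≠ 0 := by
    rintro rfl
    simp at hu
  have him : (u⁻¹).im ≠ 0 := by
    rw [inv_im]
    exact div_ne_zero (neg_ne_zero.2 hu) (normSq_pos.2 hu0).ne'
  have hc1 : u⁻¹ ∈ cutPlane := mem_cutPlane_of_im_ne_zero him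
  have hc2 : -u⁻¹ ∈ cutPlane := mem_cutPlane_of_im_ne_zero (by simpa using him)
  have hinv := hasDerivAt_inv hu0
  have h1 : HasDerivAt (fun u : ℂ => lerchCont (k + 1) u⁻¹) _ u :=
    (differentiableAt_lerchCont hb hc1).hasDerivAt.comp u hinv
  have h2 : HasDerivAt (fun u : ℂ => lerchCont (k + 1) (-u⁻¹)) _ u :=
    HasDerivAt.comp (h := fun u : ℂ => -u⁻¹) u (differentiableAt_lerchCont hb hc2).hasDerivAt
      hinv.fun_neg
  refine ⟨_, hinv.mul (h1.add h2), ?_⟩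
  have e1 := mul_deriv_lerchCont hb hc1
  have e2 := mul_deriv_lerchCont hb hc2
  have n1 : 1 - u ≠ 0 := by
    intro h
    have := congrArg Complex.im h
    simp at this
    exact hu this
  have n2 : 1 + u ≠ 0 := by
    intro h
    have := congrArg Complex.im h
    simp at this
    exact hu this
  have e3 : u⁻¹ * ((1 - u⁻¹)⁻¹ + (1 - -u⁻¹)⁻¹) = -(2 * u * (1 - u ^ 2)⁻¹) := by
    have n3 : u - 1 ≠ 0 := by
      rw [← neg_sub]
      exact neg_ne_zero.2 n1
    have n4 : u + 1 ≠ 0 := by rwa [add_comm]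
    rw [show 1 - u⁻¹ = (u - 1) / u by field_simp, show 1 - -u⁻¹ = (u + 1) / u by field_simp; ring,
      show 1 - u ^ 2 = -((u - 1) * (u + 1)) by ring]
    field_simp
    ring
  simp only [oddRecip]
  generalize deriv (lerchCont (k + 1)) u⁻¹ = d1 at *
  generalize deriv (lerchCont (k + 1)) (-u⁻¹) = d2 at *
  generalize lerchCont (k + 1) u⁻¹ = g1 at *
  generalize lerchCont (k + 1) (-u⁻¹) = g2 at *
  have e4 : u * (-(u ^ 2)⁻¹ * (g1 + g2) + u⁻¹ * (d1 * -(u ^ 2)⁻¹ + d2 * - -(u ^ 2)⁻¹)) =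
      -u⁻¹ * (g1 + g2) - u⁻¹ * (u⁻¹ * d1 + -u⁻¹ * d2) := by
    field_simp
    ring
  rw [e4, e1, e2]
  linear_combination -e3

/-- The difference solves the homogeneous equation `u f' = k f`, so `u^(-k)` times it is constant on
the convex half-disc. -/
theorem exists_oddRecip_eq {k : ℂ} (hk : -1 < k.re)
    (hk' : ∀ n : ℕ, (n : ℂ) + (1 - k) / 2 ≠ 0) :
    ∃ C : ℂ, ∀ u ∈ {u : ℂ | 0 < u.im} ∩ Metric.ball 0 1,
      oddRecip k u = oddSeries k u + C * u ^ k := by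
  have hopen : IsOpen ({u : ℂ | 0 < u.im} ∩ Metric.ball (0 : ℂ) 1) :=
    (isOpen_lt continuous_const Complex.continuous_im).inter Metric.isOpen_ball
  have hconv : Convex ℝ ({u : ℂ | 0 < u.im} ∩ Metric.ball (0 : ℂ) 1) :=
    (convex_halfSpace_im_gt 0).inter (convex_ball 0 1)
  have hder : ∀ u ∈ {u : ℂ | 0 < u.im} ∩ Metric.ball (0 : ℂ) 1,
      HasDerivAt (fun u => u ^ (-k) * (oddRecip k u - oddSeries k u)) 0 u := by
    rintro u ⟨hu, hub⟩
    have hu' : u.im ≠ 0 := ne_of_gt hu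
    have hu0 : u ≠ 0 := by
      rintro rfl
      simp at hu'
    obtain ⟨d1, h1, e1⟩ := exists_hasDerivAt_oddRecip hk hu'
    obtain ⟨d2, h2, e2⟩ := exists_hasDerivAt_oddSeries hk' hub
    have hp := (hasDerivAt_id u).cpow_const (c := -k) (Or.inr hu')
    refine (hp.mul (h1.sub h2)).congr_deriv ?_
    have e3 : u ^ (-k) = u ^ (-k - 1) * u := by
      rw [cpow_sub _ _ hu0, cpow_one]
      field_simp
    simp only [id, Pi.sub_apply]
    rw [e3]
    linear_combination u ^ (-k - 1) * (e1 - e2)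
  obtain ⟨C, hC⟩ := hopen.exists_is_const_of_deriv_eq_zero hconv.isPreconnected
    (fun z hz => (hder z hz).differentiableAt.differentiableWithinAt) fun z hz => (hder z hz).deriv
  refine ⟨C, fun u hu => ?_⟩
  have hu0 : u ≠ 0 := by
    rintro rfl
    simp at hu
  rw [← hC u hu, mul_right_comm, ← cpow_add _ _ hu0, neg_add_cancel, cpow_zero]
  ring

theorem tendsto_cpow_neg_ofReal (k : ℂ) {y : ℝ} (hy : 0 < y) :
    Tendsto (fun u : ℂ => u ^ k) (𝓝[{u : ℂ | 0 < u.im}] (-(y : ℂ)))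
      (𝓝 ((y : ℂ) ^ k * exp (Real.pi * I * k))) := by
  have h1 : Tendsto log (𝓝[{u : ℂ | 0 < u.im}] (-(y : ℂ))) (𝓝 (Real.log ‖-(y : ℂ)‖ + Real.pi * I)) :=
    (tendsto_log_nhdsWithin_im_nonneg_of_re_neg_of_im_zero (by simpa using hy) (by simp)).mono_left
      (nhdsWithin_mono _ fun u (hu : 0 < u.im) => hu.le)
  have h2 := (continuous_exp.tendsto _).comp (h1.mul_const k)
  have e : exp ((Real.log ‖-(y : ℂ)‖ + Real.pi * I) * k) = (y : ℂ) ^ k * exp (Real.pi * I * k) := by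
    have hyC : (y : ℂ) ≠ 0 := by exact_mod_cast hy.ne'
    rw [norm_neg, norm_real, Real.norm_of_nonneg hy.le, add_mul, exp_add, cpow_def_of_ne_zero hyC,
      ofReal_log hy.le]
  rw [e] at h2
  refine h2.congr' ?_
  filter_upwards [self_mem_nhdsWithin] with u hu
  have hu0 : u ≠ 0 := by
    rintro rfl
    simp at hu
  rw [cpow_def_of_ne_zero hu0]
  rfl

theorem one_add_exp_eq_zero_iff {k : ℂ} :
    1 + exp (Real.pi * I * k) = 0 ↔ ∃ n : ℤ, k = 2 * n + 1 := by
  have hpi : (Real.pi : ℂ) ≠ 0 := by exact_mod_cast Real.pi_ne_zero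
  rw [add_comm, add_eq_zero_iff_eq_neg, ← exp_pi_mul_I, exp_eq_exp_iff_exists_int]
  refine exists_congr fun n => ⟨fun h => ?_, fun h => ?_⟩
  · have h2 : (Real.pi * I) * k = (Real.pi * I) * (2 * n + 1) := by linear_combination h
    exact mul_left_cancel₀ (mul_ne_zero hpi I_ne_zero) h2
  · rw [h]
    ring

theorem I_add_tan_mul {k : ℂ} (hk : 1 + exp (Real.pi * I * k) ≠ 0) :
    (I + tan (Real.pi * k / 2)) * (1 + exp (Real.pi * I * k)) = 2 * I := by
  set E := exp (Real.pi * k / 2 * I) with hE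
  have hE0 : E ≠ 0 := exp_ne_zero _
  have h2 : exp (Real.pi * I * k) = E ^ 2 := by
    rw [hE, ← exp_nat_mul]
    congr 1
    push_cast
    ring
  rw [h2] at hk ⊢
  have h3 : exp (-(Real.pi * k / 2) * I) = E⁻¹ := by rw [neg_mul, exp_neg]
  rw [tan, Complex.sin, Complex.cos, h3, ← hE]
  have h4 : E + E⁻¹ ≠ 0 := by
    rw [show E + E⁻¹ = (1 + E ^ 2) / E by field_simp; ring]
    exact div_ne_zero hk hE0
  have h5 : E ^ 2 + 1 ≠ 0 := by rwa [add_comm]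
  field_simp
  ring

/-- The connection formula between the lower boundary values on the cut and the series at the
reciprocal argument. -/
theorem exists_tendsto_lerchCont_inv {k : ℂ} (hk : -1 < k.re)
    (hk' : ∀ n : ℕ, (n : ℂ) + (1 - k) / 2 ≠ 0) (he : 1 + exp (Real.pi * I * k) ≠ 0)
    {y : ℝ} (hy0 : 0 < y) (hy1 : y < 1) :
    ∃ ℓ : ℂ, Tendsto (lerchCont (k + 1)) (𝓝[{w : ℂ | w.im < 0}] ((y⁻¹ : ℝ) : ℂ)) (𝓝 ℓ) ∧
      (y : ℂ)⁻¹ * (ℓ + lerchCont (k + 1) (-(y : ℂ)⁻¹)) = y * lerch ((1 - k) / 2) ((y : ℂ) ^ 2) -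
        Real.pi * (I + tan (Real.pi * k / 2)) * (y : ℂ) ^ k := by
  have hb : 0 < (k + 1).re := by
    rw [add_re, one_re]
    linarith
  have hyC : (y : ℂ) ≠ 0 := by exact_mod_cast hy0.ne'
  obtain ⟨ℓ, hlow, hup⟩ := exists_tendsto_lerchCont hb ((one_lt_inv₀ hy0).2 hy1)
  rw [ofReal_inv] at hlow hup ⊢
  refine ⟨ℓ, hlow, ?_⟩
  obtain ⟨C, hC⟩ := exists_oddRecip_eq hk hk'
  have hyball : (y : ℂ) ∈ Metric.ball (0 : ℂ) 1 := by
    simpa [abs_of_pos hy0] using hy1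
  have hyball' : -(y : ℂ) ∈ Metric.ball (0 : ℂ) 1 := by simpa using hyball
  have hinv_im : ∀ u : ℂ, 0 < u.im → (u⁻¹).im < 0 := by
    intro u hu
    have hu0 : u ≠ 0 := by
      rintro rfl
      simp at hu
    rw [inv_im]
    exact div_neg_of_neg_of_pos (neg_lt_zero.2 hu) (normSq_pos.2 hu0)
  have hcut : -(y : ℂ)⁻¹ ∈ cutPlane := by
    refine Or.inl ?_
    rw [← ofReal_inv, ← ofReal_neg, sub_re, one_re, ofReal_re]
    have := inv_pos.2 hy0
    linarith
  have hcont : ContinuousAt (lerchCont (k + 1)) (-(y : ℂ)⁻¹) :=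
    (differentiableAt_lerchCont hb hcut).continuousAt
  have hinv : ∀ a : ℂ, a ≠ 0 → Tendsto (fun u : ℂ => u⁻¹) (𝓝[{u : ℂ | 0 < u.im}] a) (𝓝 a⁻¹) :=
    fun a ha => (tendsto_inv₀ ha).mono_left nhdsWithin_le_nhds
  have hinvlow : Tendsto (fun u : ℂ => u⁻¹) (𝓝[{u : ℂ | 0 < u.im}] (y : ℂ))
      (𝓝[{w : ℂ | w.im < 0}] (y : ℂ)⁻¹) := by
    refine tendsto_nhdsWithin_iff.2 ⟨hinv _ hyC, ?_⟩
    filter_upwards [self_mem_nhdsWithin] with u hu using hinv_im u hu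
  have hnyC : -(y : ℂ) ≠ 0 := neg_ne_zero.2 hyC
  have hinvup : Tendsto (fun u : ℂ => -u⁻¹) (𝓝[{u : ℂ | 0 < u.im}] (-(y : ℂ)))
      (𝓝[{w : ℂ | 0 < w.im}] (y : ℂ)⁻¹) := by
    refine tendsto_nhdsWithin_iff.2 ⟨?_, ?_⟩
    · have := (hinv _ hnyC).neg
      rwa [inv_neg, neg_neg] at this
    · filter_upwards [self_mem_nhdsWithin] with u hu
      have := hinv_im u hu
      simpa using this
  have hH1 : Tendsto (oddRecip k) (𝓝[{u : ℂ | 0 < u.im}] (y : ℂ))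
      (𝓝 ((y : ℂ)⁻¹ * (ℓ + lerchCont (k + 1) (-(y : ℂ)⁻¹)))) :=
    (hinv _ hyC).mul ((hlow.comp hinvlow).add (hcont.tendsto.comp (hinv _ hyC).neg))
  -- As `u → -y` from above, `-u⁻¹` reaches `y⁻¹` from the upper side, so the jump enters here,
  -- whereas `u → y` sees only the lower value `ℓ`.
  have hH2 : Tendsto (oddRecip k) (𝓝[{u : ℂ | 0 < u.im}] (-(y : ℂ)))
      (𝓝 ((-(y : ℂ))⁻¹ * (lerchCont (k + 1) (-(y : ℂ)⁻¹) +
        (ℓ + 2 * Real.pi * I * (y : ℂ)⁻¹ ^ (-(k + 1)))))) := by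
    refine (hinv _ hnyC).mul (Tendsto.add ?_ (hup.comp hinvup))
    have := hinv _ hnyC
    rw [inv_neg] at this
    exact hcont.tendsto.comp this
  have hR : ∀ a ∈ Metric.ball (0 : ℂ) 1, ∀ m : ℂ,
      Tendsto (fun u : ℂ => u ^ k) (𝓝[{u : ℂ | 0 < u.im}] a) (𝓝 m) →
      Tendsto (oddRecip k) (𝓝[{u : ℂ | 0 < u.im}] a) (𝓝 (oddSeries k a + C * m)) := by
    intro a ha m hm
    refine (((continuousAt_oddSeries k ha).tendsto.mono_left nhdsWithin_le_nhds).add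
      (hm.const_mul C)).congr' ?_
    filter_upwards [self_mem_nhdsWithin,
      nhdsWithin_le_nhds (Metric.isOpen_ball.mem_nhds ha)] with u hu hub
    exact (hC u ⟨hu, hub⟩).symm
  have hpow : Tendsto (fun u : ℂ => u ^ k) (𝓝[{u : ℂ | 0 < u.im}] (y : ℂ)) (𝓝 ((y : ℂ) ^ k)) :=
    ((hasDerivAt_id (y : ℂ)).cpow_const
      (Or.inl (by simpa using hy0))).continuousAt.tendsto.mono_left nhdsWithin_le_nhds
  have nb1 := neBot_nhdsWithin_im_pos y
  have nb2 := neBot_nhdsWithin_im_pos (-y)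
  rw [ofReal_neg] at nb2
  have E1 := tendsto_nhds_unique hH1 (hR _ hyball _ hpow)
  have E2 := tendsto_nhds_unique hH2 (hR _ hyball' _ (tendsto_cpow_neg_ofReal k hy0))
  have e3 : (y : ℂ)⁻¹ ^ (-(k + 1)) = (y : ℂ) ^ k * y := by
    have harg : arg (y : ℂ) ≠ Real.pi := by
      rw [arg_ofReal_of_nonneg hy0.le]
      exact Real.pi_ne_zero.symm
    rw [inv_cpow _ _ harg, cpow_neg, inv_inv, cpow_add _ _ hyC, cpow_one]
  have e4 : oddSeries k (-(y : ℂ)) = -oddSeries k y := by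
    simp [oddSeries]
  have hyk : (y : ℂ) ^ k ≠ 0 := by simp [cpow_eq_zero_iff, hyC]
  -- Both `oddRecip` (apart from the jump) and `oddSeries` are odd, so adding the two boundary
  -- identities leaves only `C` and the jump.
  have hCval : C * (1 + exp (Real.pi * I * k)) = -(2 * Real.pi * I) := by
    rw [e3, e4, inv_neg] at E2
    refine mul_left_cancel₀ hyk ?_
    have e5 : (y : ℂ)⁻¹ * y = 1 := inv_mul_cancel₀ hyC
    linear_combination -E1 - E2 - 2 * Real.pi * I * (y : ℂ) ^ k * e5
  have hC2 : C = -(Real.pi * (I + tan (Real.pi * k / 2))) := by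
    refine mul_right_cancel₀ he ?_
    rw [hCval]
    linear_combination (Real.pi : ℂ) * I_add_tan_mul he
  rw [E1, hC2, oddSeries]
  ring

/-! ### Both sides in closed form -/

/-- The common closed form of both sides of the symmetrized identity. -/
def closedForm (y : ℝ) (k : ℂ) : ℂ :=
  (y : ℂ) ^ 2 / (1 + (y : ℂ) ^ 2) *
    (lerch ((1 + k) / 2) ((y : ℂ) ^ 2) + lerch ((1 - k) / 2) ((y : ℂ) ^ 2))

theorem natCast_add_half_ne_zero {k : ℂ} (hk : -1 < k.re) (n : ℕ) : (n : ℂ) + (1 + k) / 2 ≠ 0 := by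
  refine natCast_add_ne_zero ?_ n
  rw [div_ofNat_re, add_re, one_re]
  linarith

theorem natCast_add_half_sub_ne_zero {k : ℂ} (hodd : ∀ m : ℕ, k ≠ 2 * (m : ℂ) + 1) (n : ℕ) :
    (n : ℂ) + (1 - k) / 2 ≠ 0 := fun h => hodd n (by linear_combination -2 * h)

/-- The zeros are the odd integers; `Re k > -1` excludes the negative ones. -/
theorem one_add_exp_ne_zero {k : ℂ} (hk : -1 < k.re) (hodd : ∀ m : ℕ, k ≠ 2 * (m : ℂ) + 1) :
    1 + exp (Real.pi * I * k) ≠ 0 := by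
  rw [Ne, one_add_exp_eq_zero_iff]
  rintro ⟨n, hn⟩
  have h1 := congrArg Complex.re hn
  simp at h1
  have h2 : (-1 : ℝ) < n := by linarith
  have h3 : (-1 : ℤ) < n := by exact_mod_cast h2
  obtain ⟨m, rfl⟩ := Int.eq_ofNat_of_zero_le (show 0 ≤ n by lia)
  exact hodd m (by simpa using hn)

theorem one_add_sq_ne_zero (y : ℝ) : (1 : ℂ) + (y : ℂ) ^ 2 ≠ 0 := by
  exact_mod_cast (by positivity : (1 : ℝ) + y ^ 2 ≠ 0)

theorem one_sub_sq_ne_zero {y : ℝ} (hy0 : 0 < y) (hy1 : y < 1) : (1 : ℂ) - (y : ℂ) ^ 2 ≠ 0 := by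
  exact_mod_cast (sub_pos.2 (pow_lt_one₀ hy0.le hy1 two_ne_zero)).ne'

theorem lhs_eq_closedForm {k : ℂ} (hk : -1 < k.re) (hodd : ∀ m : ℕ, k ≠ 2 * (m : ℂ) + 1)
    {y : ℝ} (hy0 : 0 < y) (hy1 : y < 1) : lhs k y = closedForm y k := by
  have h1 := natCast_add_half_ne_zero hk
  have h2 := natCast_add_half_sub_ne_zero hodd
  have e1 := termA_eq h1 h2 hy0 hy1
  have e2 := termA_eq (k := -k) (by simpa only [← sub_eq_add_neg] using h2)
    (by simpa only [sub_neg_eq_add] using h1) hy0 hy1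
  rw [sub_neg_eq_add, ← sub_eq_add_neg] at e2
  have n1 := one_sub_sq_ne_zero hy0 hy1
  have n2 := one_add_sq_ne_zero y
  rw [lhs, closedForm, e1, e2,
    show (1 : ℂ) - (y : ℂ) ^ 4 = (1 - (y : ℂ) ^ 2) * (1 + (y : ℂ) ^ 2) by ring]
  field_simp
  ring

/-- `termB` in terms of the first of the two pairs of hypergeometric values. -/
theorem termB_eq {k x g₁ g₂ h₁ h₂ : ℂ} (hk0 : k ≠ 0) (hk1 : k + 1 ≠ 0) (hk2 : k + 2 ≠ 0)
    (hx0 : x ≠ 0) (hx1 : x ^ 2 - 1 ≠ 0) (hx2 : x ^ 2 + 1 ≠ 0)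
    (e₁ : F21 1 k (k + 1) x = 1 + k * x * g₁) (e₂ : F21 1 k (k + 1) (-x) = 1 + k * -x * g₂)
    (e₃ : F21 1 (k + 2) (k + 3) x = 1 + (k + 2) * x * h₁)
    (e₄ : F21 1 (k + 2) (k + 3) (-x) = 1 + (k + 2) * -x * h₂)
    (r₁ : g₁ = (k + 1)⁻¹ + x * ((k + 2)⁻¹ + x * h₁))
    (r₂ : g₂ = (k + 1)⁻¹ + -x * ((k + 2)⁻¹ + -x * h₂)) :
    termB k x = x ^ 2 / (x ^ 2 + 1) * (g₁ + g₂) +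
      2 * x ^ 2 / ((x ^ 2 - 1) * (x ^ 2 + 1) * (k + 1)) := by
  rw [termB, e₁, e₂, e₃, e₄, r₁, r₂,
    show x ^ 2 - x⁻¹ ^ 2 = (x ^ 2 - 1) * (x ^ 2 + 1) / x ^ 2 by field_simp; ring]
  field_simp
  ring

theorem rhs_eq_closedForm {k : ℂ} (hk : -1 < k.re) (hodd : ∀ m : ℕ, k ≠ 2 * (m : ℂ) + 1)
    (hk0 : k ≠ 0) {y : ℝ} (hy0 : 0 < y) (hy1 : y < 1) : rhs k y = closedForm y k := by
  have hb : 0 < (k + 1).re := by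
    rw [add_re, one_re]
    linarith
  have hb1 : 0 < (k + 1 + 1).re := by
    rw [add_re, one_re]
    linarith
  have hk2re : -1 < (k + 2).re := by
    rw [add_re, re_ofNat]
    linarith
  have hk1 : k + 1 ≠ 0 := by simpa using natCast_add_ne_zero hb 0
  have hk2 : k + 2 ≠ 0 := by
    rw [show k + 2 = k + 1 + 1 by ring]
    simpa using natCast_add_ne_zero hb1 0
  have hyC : (y : ℂ) ≠ 0 := by exact_mod_cast hy0.ne'
  have n1 := one_sub_sq_ne_zero hy0 hy1
  have n2 := one_add_sq_ne_zero y
  have n1' : (y : ℂ) ^ 2 - 1 ≠ 0 := by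
    rw [← neg_sub]
    exact neg_ne_zero.2 n1
  have n2' : (y : ℂ) ^ 2 + 1 ≠ 0 := by rwa [add_comm]
  have hrec : ∀ z ∈ cutPlane,
      lerchCont (k + 1) z = (k + 1)⁻¹ + z * ((k + 2)⁻¹ + z * lerchCont (k + 3) z) := by
    intro z hz
    rw [lerchCont_eq_inv_add hb hz, lerchCont_eq_inv_add hb1 hz, show k + 1 + 1 = k + 2 by ring,
      show k + 2 + 1 = k + 3 by ring]
  have hF : ∀ z ∈ cutPlane, F21 1 (k + 2) (k + 3) z = 1 + (k + 2) * z * lerchCont (k + 3) z := by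
    intro z hz
    have := F21_eq hk2re hz
    rwa [show k + 2 + 1 = k + 3 by ring] at this
  have hyball : (y : ℂ) ∈ Metric.ball (0 : ℂ) 1 := by
    simpa [abs_of_pos hy0] using hy1
  have hyball' : -(y : ℂ) ∈ Metric.ball (0 : ℂ) 1 := by simpa using hyball
  have c1 := ball_subset_cutPlane hyball
  have c2 := ball_subset_cutPlane hyball'
  have c3 : -(y : ℂ)⁻¹ ∈ cutPlane := by
    refine Or.inl ?_
    rw [← ofReal_inv, ← ofReal_neg, sub_re, one_re, ofReal_re]
    have := inv_pos.2 hy0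
    linarith
  have B1 := termB_eq hk0 hk1 hk2 hyC n1' n2' (F21_eq hk c1) (F21_eq hk c2) (hF _ c1) (hF _ c2)
    (hrec _ c1) (hrec _ c2)
  rw [lerchCont_eqOn hb hyball, lerchCont_eqOn hb hyball', lerch_add_lerch_neg _ hyball,
    add_comm k 1] at B1
  obtain ⟨ℓ, hℓ, hval⟩ := exists_tendsto_lerchCont_inv hk (natCast_add_half_sub_ne_zero hodd)
    (one_add_exp_ne_zero hk hodd) hy0 hy1
  have hx : 1 < y⁻¹ := (one_lt_inv₀ hy0).2 hy1
  -- The limit at parameter `k + 3` comes from solving the two-step recursion `hrec` for its last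
  -- term, with `w⁻¹ → y`.
  have hℓ' : Tendsto (lerchCont (k + 2 + 1)) (𝓝[{w : ℂ | w.im < 0}] ((y⁻¹ : ℝ) : ℂ))
      (𝓝 (y * (y * (ℓ - (k + 1)⁻¹) - (k + 2)⁻¹))) := by
    have hinv : Tendsto (fun w : ℂ => w⁻¹) (𝓝[{w : ℂ | w.im < 0}] ((y⁻¹ : ℝ) : ℂ)) (𝓝 (y : ℂ)) := by
      have := (tendsto_inv₀ (x := ((y⁻¹ : ℝ) : ℂ)) (by simpa using hyC)).mono_left
        (nhdsWithin_le_nhds (s := {w : ℂ | w.im < 0}))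
      simpa using this
    refine (hinv.mul ((hinv.mul (hℓ.sub_const _)).sub_const _)).congr' ?_
    filter_upwards [self_mem_nhdsWithin] with w hw
    have hw0 : w ≠ 0 := by
      rintro rfl
      simp at hw
    rw [hrec w (mem_cutPlane_of_im_ne_zero (ne_of_lt hw)), show k + 2 + 1 = k + 3 by ring]
    generalize lerchCont (k + 3) w = g
    rw [add_sub_cancel_left, inv_mul_cancel_left₀ hw0, add_sub_cancel_left,
      inv_mul_cancel_left₀ hw0]
  have f1 := F21_eq_of_tendsto hk hx hℓ
  have f3 := F21_eq_of_tendsto hk2re hx hℓ'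
  rw [show k + 2 + 1 = k + 3 by ring] at f3
  rw [ofReal_inv] at f1 f3
  have m1 : (y : ℂ)⁻¹ ^ 2 - 1 ≠ 0 := by
    rw [show (y : ℂ)⁻¹ ^ 2 - 1 = (1 - (y : ℂ) ^ 2) / (y : ℂ) ^ 2 by field_simp]
    exact div_ne_zero n1 (pow_ne_zero 2 hyC)
  have m2 : (y : ℂ)⁻¹ ^ 2 + 1 ≠ 0 := by
    rw [show (y : ℂ)⁻¹ ^ 2 + 1 = (1 + (y : ℂ) ^ 2) / (y : ℂ) ^ 2 by field_simp]
    exact div_ne_zero n2 (pow_ne_zero 2 hyC)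
  have B2 := termB_eq hk0 hk1 hk2 (inv_ne_zero hyC) m1 m2 f1 (F21_eq hk c3) f3 (hF _ c3)
    (by field_simp; ring) (hrec _ c3)
  have hsum : ℓ + lerchCont (k + 1) (-(y : ℂ)⁻¹) = y * (y * lerch ((1 - k) / 2) ((y : ℂ) ^ 2) -
      Real.pi * (I + tan (Real.pi * k / 2)) * (y : ℂ) ^ k) := by
    rw [← hval, mul_inv_cancel_left₀ hyC]
  rw [hsum] at B2
  rw [rhs, B1, B2, closedForm,
    show (y : ℂ)⁻¹ ^ 2 - 1 = (1 - (y : ℂ) ^ 2) / (y : ℂ) ^ 2 by field_simp,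
    show (y : ℂ)⁻¹ ^ 2 + 1 = (1 + (y : ℂ) ^ 2) / (y : ℂ) ^ 2 by field_simp,
    show (y : ℂ) + (y : ℂ)⁻¹ = (1 + (y : ℂ) ^ 2) / y by field_simp; ring,
    show (y : ℂ) ^ 2 - 1 = -(1 - (y : ℂ) ^ 2) by ring, add_comm ((y : ℂ) ^ 2) 1, add_comm k 1]
  rw [add_comm k 1] at hk1
  generalize lerch ((1 + k) / 2) ((y : ℂ) ^ 2) = A
  generalize lerch ((1 - k) / 2) ((y : ℂ) ^ 2) = B
  generalize tan (Real.pi * k / 2) = t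
  generalize (y : ℂ) ^ k = p
  field_simp
  ring

theorem continuousAt_closedForm {y : ℝ} (hy0 : 0 < y) (hy1 : y < 1) :
    ContinuousAt (closedForm y) 0 := by
  have hw : (y : ℂ) ^ 2 ∈ Metric.ball (0 : ℂ) 1 :=
    sq_mem_ball (by simpa [abs_of_pos hy0] using hy1)
  have h := continuousAt_lerch_half hw
  refine ContinuousAt.mul continuousAt_const (ContinuousAt.add ?_ ?_)
  · exact ContinuousAt.comp_of_eq (g := fun b => lerch b ((y : ℂ) ^ 2))
      (f := fun k : ℂ => (1 + k) / 2) h (by fun_prop) (by norm_num)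
  · exact ContinuousAt.comp_of_eq (g := fun b => lerch b ((y : ℂ) ^ 2))
      (f := fun k : ℂ => (1 - k) / 2) h (by fun_prop) (by norm_num)

end Hypergeom

end

theorem mainTheorem5 (k : ℂ) (hk : -1 < k.re) (hodd : ∀ m : ℕ, k ≠ 2 * (m : ℂ) + 1)
    (y : ℝ) (hy0 : 0 < y) (hy1 : y < 1) :
    (k ≠ 0 → Hypergeom.lhs k (y : ℂ) = Hypergeom.rhs k (y : ℂ)) ∧
      (k = 0 → Tendsto (fun κ : ℂ => Hypergeom.rhs κ (y : ℂ)) (𝓝[≠] 0)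
        (𝓝 (Hypergeom.lhs 0 (y : ℂ)))) := by
  refine ⟨fun hk0 => ?_, ?_⟩
  · rw [Hypergeom.lhs_eq_closedForm hk hodd hy0 hy1,
      Hypergeom.rhs_eq_closedForm hk hodd hk0 hy0 hy1]
  · rintro rfl
    rw [Hypergeom.lhs_eq_closedForm hk hodd hy0 hy1]
    refine ((Hypergeom.continuousAt_closedForm hy0 hy1).tendsto.mono_left
      nhdsWithin_le_nhds).congr' ?_
    -- In the unit disc `|Re κ| < 1`, so `κ` is no positive odd integer and the closed form of the
    -- right side applies off `0`.
    filter_upwards [self_mem_nhdsWithin,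
      nhdsWithin_le_nhds (Metric.ball_mem_nhds (0 : ℂ) one_pos)] with κ hκ0 hκ
    have h1 := (Complex.abs_re_le_norm κ).trans_lt (mem_ball_zero_iff.1 hκ)
    have h2 := abs_lt.1 h1
    refine (Hypergeom.rhs_eq_closedForm h2.1 (fun m hm => ?_) hκ0 hy0 hy1).symm
    have h3 := congrArg Complex.re hm
    simp at h3
    linarith [m.cast_nonneg (α := ℝ)]
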